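/- Let $n\ge 1$ and $v_1,\dots,v_n>0$. PushASEP with a wall is the continuous-time Markov chain $Y=(Y_1(t),\dots,Y_n(t))_{t\ge 0}$ on $W^n_{\ge 0}=\{y\in\mathbb Z^n: 0\le y_1\le\dots\le y_n\}$ with the following transition rates, where $e_i$ is the $i$-th unit vector and $y_{n+1}=\infty$: for $i\le j$ it jumps from $y$ to $y+e_i+e_{i+1}+\dots+e_j$ at rate $v_i\mathbf 1\{y_i=\dots=y_j<y_{j+1}\}$; it jumps from $y$ to $y-e_i$ at rate $v_i^{-1}\mathbf 1\{y-e_i\in W^n_{\ge0}\}$; all other transition rates are zero. For $f:\mathbb Z\to\mathbb R$ and $v>0$ put $$D^{(v)}f(u)=f(u)-vf(u-1),\qquad J^{(v)}f(u)=\sum_{j=u}^\infty v^{u-j}f(j),$$ write $D^{(w_1\dots w_m)}=D^{(w_1)}\cdots D^{(w_m)}$ and $J^{(w_1\dots w_m)}=J^{(w_1)}\cdots J^{(w_m)}$ for compositions, and let a subscript name the variable on which an operator acts. For $t\ge 0$ and $x,y\in\mathbb Z$ let $$\psi_t(x,y)=\frac1{2\pi i}\oint_{|z|=1}\frac{dz}{z}\,\bigl(z^{y-x}-z^{x+y+2}\bigr)e^{t(z+1/z)},$$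 where the unit circle is oriented anticlockwise, and for $x,y\in\mathbb Z^n$ let $$r_t(x,y)=\prod_{k=1}^n v_k^{y_k-x_k}e^{-t(v_k+1/v_k)}\;\det\bigl(F_{ij}(t;x_i+i-1,y_j+j-1)\bigr)_{i,j=1}^n,\qquad F_{ij}(t;u,w)=D_w^{(1/v_1\dots 1/v_j)}J_u^{(v_1\dots v_i)}\psi_t(u,w).$$ Then the transition probabilities of PushASEP with a wall are given by $r_t(x,y)$, for $x,y\in W^n_{\ge0}$ and $t\ge0$. That is, $(r_t)_{t\ge0}$ restricted to $W^n_{\ge 0}$ is the unique stochastic transition function (non-negative, with rows summing to one, satisfying $r_0=\mathrm{Id}$ and the Chapman–Kolmogorov equations) whose derivative at $t=0^+$ is the Q-matrix of the rates above (off-diagonal entries the given rates, diagonal entries minus the total exit rates); and for every continuous-time Markov chain $Y$ with these rates, $P(Y(s+t)=y\mid Y(s)=x)=r_t(x,y)$ for all $s,t\ge0$ and $x,y\in W^n_{\ge0}$ with $P(Y(s)=x)>0$. -/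

import Mathlib

open MeasureTheory ProbabilityTheory Filter Topology
open scoped NNReal

noncomputable section

namespace PushASEP

/-! ### Continuous-time Markov chains with given transition rates -/

section MarkovChains

variable {S : Type*}

open Classical in
/-- The (conservative) Q-matrix of the transition rates `q x y`, `x ≠ y`: the diagonal entry
is minus the total rate of leaving the state. -/
def qMatrix (q : S → S → ℝ) (x y : S) : ℝ :=
  if x = y then -∑' z, (if z = x then 0 else q x z) else q x y

open Classical in
/-- `P t x y` is a (stochastic) transition function on the countable set `S` whose
Q-matrix is that of the transition rates `q`, i.e. `P` is a family of transition probabilities of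
a continuous-time Markov chain with transition rates `q`. -/
structure IsTransitionFunction (q : S → S → ℝ) (P : ℝ≥0 → S → S → ℝ) : Prop where
  nonneg : ∀ t x y, 0 ≤ P t x y
  sum_eq_one : ∀ t x, HasSum (fun y => P t x y) 1
  zero : ∀ x y, P 0 x y = if x = y then 1 else 0
  chapman_kolmogorov : ∀ s t x y, HasSum (fun z => P s x z * P t z y) (P (s + t) x y)
  rates : ∀ x y,
    Tendsto (fun h : ℝ≥0 => (P h x y - P 0 x y) / (h : ℝ)) (𝓝[>] 0) (𝓝 (qMatrix q x y))

/-- The σ-algebra generated by `Y u`, `u ≤ s`. -/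
abbrev past {Ω : Type*} (Y : ℝ≥0 → Ω → S) (s : ℝ≥0) : MeasurableSpace Ω :=
  ⨆ u : ℝ≥0, ⨆ _ : u ≤ s, MeasurableSpace.comap (Y u) ⊤

/-- `Y` is a time-homogeneous continuous-time Markov chain with transition rates `q`
on the probability space `(Ω, μ)`. -/
structure IsMarkovChain {Ω : Type*} [MeasurableSpace Ω] (q : S → S → ℝ)
    (Y : ℝ≥0 → Ω → S) (μ : Measure Ω) : Prop where
  measurable : ∀ (t : ℝ≥0) (A : Set S), MeasurableSet (Y t ⁻¹' A)
  markov : ∃ P : ℝ≥0 → S → S → ℝ, IsTransitionFunction q P ∧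
    ∀ (s t : ℝ≥0) (y : S),
      μ⟦Y (s + t) ⁻¹' {y} | past Y s⟧ =ᵐ[μ] fun ω => P t (Y s ω) y

end MarkovChains

/-! ### PushASEP with a wall -/

/-- The state space `0 ≤ y₁ ≤ … ≤ yₙ` of integer configurations. -/
def State (n : ℕ) : Type := {y : Fin n → ℤ // (∀ i, 0 ≤ y i) ∧ Monotone y}

/-- The vector `e_i + e_{i+1} + ⋯ + e_j`. -/
def block {n : ℕ} (i j : Fin n) : Fin n → ℤ := fun k => if i ≤ k ∧ k ≤ j then 1 else 0

open Classical in
/-- The transition rates of PushASEP with a wall: for `i ≤ j`, a jump from `y` to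
`y + e_i + ⋯ + e_j` has rate `v_i` if `y_i = ⋯ = y_j < y_{j+1}` (with `y_{n+1} = ∞`);
a jump from `y` to `y - e_i` has rate `1 / v_i` if `y - e_i` is in the state space (this is part
of the type of `z`). For given `y ≠ z` at most one of the summands is non-zero. -/
def rate {n : ℕ} (v : Fin n → ℝ) (y z : State n) : ℝ :=
  (∑ i, ∑ j, if i ≤ j ∧ z.1 = y.1 + block i j ∧ (∀ k, i ≤ k → k ≤ j → y.1 k = y.1 i) ∧
      (∀ k : Fin n, (k : ℕ) = (j : ℕ) + 1 → y.1 j < y.1 k) then v i else 0) +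
  ∑ i, if z.1 = y.1 - Pi.single i 1 then (v i)⁻¹ else 0

/-! ### The determinantal kernel -/

/-- The operator `D^{(v)} f(u) = f(u) - v f(u-1)`. -/
def D (v : ℝ) (f : ℤ → ℝ) (u : ℤ) : ℝ := f u - v * f (u - 1)

/-- The operator `J^{(v)} f(u) = ∑_{j ≥ u} v^{u-j} f(j)`, written with `j = u + k`. -/
def J (v : ℝ) (f : ℤ → ℝ) (u : ℤ) : ℝ := ∑' k : ℕ, v ^ (-(k : ℤ)) * f (u + (k : ℤ))

/-- The composition `D^{(w₁)} ⋯ D^{(w_m)}`. -/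
def DList (w : List ℝ) (f : ℤ → ℝ) : ℤ → ℝ := w.foldr D f

/-- The composition `J^{(w₁)} ⋯ J^{(w_m)}`. -/
def JList (w : List ℝ) (f : ℤ → ℝ) : ℤ → ℝ := w.foldr J f

/-- The contour integral defining `ψ_t(x, y)`, over the unit circle oriented anticlockwise. -/
def psiC (t : ℝ) (x y : ℤ) : ℂ :=
  (2 * Real.pi * Complex.I)⁻¹ *
    ∮ z in C(0, 1), (1 / z) * ((z ^ (y - x) - z ^ (x + y + 2)) * Complex.exp (t * (z + 1 / z)))

/-- The real number `ψ_t(x, y)`; the contour integral is real, see `psi_eq`. -/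
def psi (t : ℝ) (x y : ℤ) : ℝ := (psiC t x y).re

theorem psi_eq (t : ℝ) (x y : ℤ) : (psi t x y : ℂ) = psiC t x y := by
  have key : psiC t x y = (2 * Real.pi : ℂ)⁻¹ * ∫ θ in (0 : ℝ)..2 * Real.pi,
      ((circleMap 0 1 θ ^ (y - x) - circleMap 0 1 θ ^ (x + y + 2)) *
        Complex.exp (t * (circleMap 0 1 θ + 1 / circleMap 0 1 θ))) := by
    rw [psiC, circleIntegral, mul_inv, mul_assoc, ← intervalIntegral.integral_const_mul]
    congr 1
    apply intervalIntegral.integral_congr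
    intro θ _
    have hz : circleMap 0 1 θ ≠ 0 := circleMap_ne_center one_ne_zero
    simp only [deriv_circleMap, smul_eq_mul]
    field_simp
  have hconj : ∀ θ : ℝ, (starRingEnd ℂ) (circleMap 0 1 θ) = circleMap 0 1 (2 * Real.pi - θ) := by
    intro θ
    rw [(periodic_circleMap 0 1).sub_eq']
    simp [circleMap, ← Complex.exp_conj]
  rw [psi, ← Complex.conj_eq_iff_re, key, map_mul, ← intervalIntegral.intervalIntegral_conj]
  congr 1
  · rw [map_inv₀, map_mul, Complex.conj_ofReal, map_ofNat]
  · have hsub := intervalIntegral.integral_comp_sub_left (a := 0) (b := 2 * Real.pi)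
      (fun θ : ℝ => (circleMap 0 1 θ ^ (y - x) - circleMap 0 1 θ ^ (x + y + 2)) *
        Complex.exp (t * (circleMap 0 1 θ + 1 / circleMap 0 1 θ))) (2 * Real.pi)
    rw [sub_self, sub_zero] at hsub
    rw [← hsub]
    apply intervalIntegral.integral_congr
    intro θ _
    simp only [map_mul, map_sub, map_zpow₀, ← Complex.exp_conj, map_add, map_div₀, map_one,
      hconj, Complex.conj_ofReal]

/-- The list `(v_1, …, v_i)`; `i : Fin n` stands for the index `i + 1`. -/
def prefixList {n : ℕ} (v : Fin n → ℝ) (i : Fin n) : List ℝ := (List.ofFn v).take ((i : ℕ) + 1)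

/-- `F_{ij}(t; u, w) = D_w^{(1/v_1 … 1/v_j)} J_u^{(v_1 … v_i)} ψ_t(u, w)`. -/
def F {n : ℕ} (v : Fin n → ℝ) (i j : Fin n) (t : ℝ) (u w : ℤ) : ℝ :=
  DList ((prefixList v j).map (fun a => 1 / a))
    (fun w' => JList (prefixList v i) (fun u' => psi t u' w') u) w

/-- `r_t(x, y)`; as indices start from `0` here, `x_i + i - 1` is written `x i + i`. -/
def r {n : ℕ} (v : Fin n → ℝ) (t : ℝ) (x y : Fin n → ℤ) : ℝ :=
  (∏ k, v k ^ (y k - x k) * Real.exp (-t * (v k + 1 / v k))) *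
    (Matrix.of fun i j : Fin n => F v i j t (x i + (i : ℕ)) (y j + (j : ℕ))).det

end PushASEP

end

noncomputable section

namespace PushASEP

section Generator

variable {S ι : Type*} [Fintype ι]

/-- The generator of the chain which applies the move `m i` at rate `c i`. -/
def gen (c : ι → ℝ) (m : ι → S → S) (f : S → ℝ) (x : S) : ℝ := ∑ i, c i * (f (m i x) - f x)

theorem gen_sub (c : ι → ℝ) (m : ι → S → S) (f g : S → ℝ) (x : S) :
    gen c m (fun z => f z - g z) x = gen c m f x - gen c m g x := by
  simp only [gen, ← Finset.sum_sub_distrib]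
  exact Finset.sum_congr rfl fun i _ => by ring

theorem abs_gen_le (c : ι → ℝ) (hc : ∀ i, 0 ≤ c i) (m : ι → S → S) {f : S → ℝ} {C : ℝ}
    (hf : ∀ x, |f x| ≤ C) (x : S) : |gen c m f x| ≤ 2 * (∑ i, c i) * C := by
  calc |gen c m f x| ≤ ∑ i, |c i * (f (m i x) - f x)| := Finset.abs_sum_le_sum_abs _ _
    _ ≤ ∑ i, c i * (C + C) := by
        refine Finset.sum_le_sum fun i _ => ?_
        rw [abs_mul, abs_of_nonneg (hc i)]
        exact mul_le_mul_of_nonneg_left ((abs_sub _ _).trans (add_le_add (hf _) (hf _))) (hc i)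
    _ = 2 * (∑ i, c i) * C := by rw [← Finset.sum_mul]; ring

/-- `g` is a locally bounded solution of the backward equation of the generator `gen c m`. -/
structure SolvesBackward (c : ι → ℝ) (m : ι → S → S) (g : ℝ → S → ℝ) : Prop where
  continuousOn : ∀ x, ContinuousOn (fun t => g t x) (Set.Ici 0)
  hasDeriv : ∀ t, 0 ≤ t → ∀ x,
    HasDerivWithinAt (fun t => g t x) (gen c m (g t) x) (Set.Ici t) t
  bounded : ∀ T, ∃ C, ∀ t ∈ Set.Icc 0 T, ∀ x, |g t x| ≤ C

theorem SolvesBackward.sub {c : ι → ℝ} {m : ι → S → S} {f g : ℝ → S → ℝ}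
    (hf : SolvesBackward c m f) (hg : SolvesBackward c m g) :
    SolvesBackward c m (fun t x => f t x - g t x) where
  continuousOn x := (hf.continuousOn x).sub (hg.continuousOn x)
  hasDeriv t ht x := by
    rw [gen_sub]
    exact (hf.hasDeriv t ht x).sub (hg.hasDeriv t ht x)
  bounded T := by
    obtain ⟨C, hC⟩ := hf.bounded T
    obtain ⟨C', hC'⟩ := hg.bounded T
    exact ⟨C + C', fun t ht x => (abs_sub _ _).trans (add_le_add (hC t ht x) (hC' t ht x))⟩

theorem SolvesBackward.eq_zero {c : ι → ℝ} (hc : ∀ i, 0 ≤ c i) {m : ι → S → S} {g : ℝ → S → ℝ}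
    (hg : SolvesBackward c m g) (h0 : ∀ x, g 0 x = 0) {T : ℝ} (hT : 0 ≤ T) (x : S) :
    g T x = 0 := by
  obtain ⟨C, hC⟩ := hg.bounded T
  set K := 2 * ∑ i, c i with hK
  have key : ∀ k : ℕ, ∀ t ∈ Set.Icc 0 T, ∀ x, |g t x| ≤ C * ((K * t) ^ k / k.factorial) := by
    intro k
    induction k with
    | zero => intro t ht x; simpa using hC t ht x
    | succ k ih =>
      intro t ht x
      have hB : ∀ s : ℝ, HasDerivAt (fun s => C * ((K * s) ^ (k + 1) / (k + 1).factorial))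
          (K * (C * ((K * s) ^ k / k.factorial))) s := by
        intro s
        have h1 : HasDerivAt (fun s => K * s) K s := by
          simpa using (hasDerivAt_id s).const_mul K
        refine (((h1.pow (k + 1)).div_const ((k + 1).factorial : ℝ)).const_mul C).congr_deriv ?_
        rw [Nat.factorial_succ]
        have : (k.factorial : ℝ) ≠ 0 := by positivity
        push_cast
        field_simp
      exact image_norm_le_of_norm_deriv_right_le_deriv_boundary (a := 0) (b := T)
        (f := fun t => g t x) (f' := fun t => gen c m (g t) x)
        ((hg.continuousOn x).mono Set.Icc_subset_Ici_self)
        (fun s hs => hg.hasDeriv s hs.1 x) (by simp [h0 x]) hB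
        (fun s hs => abs_gen_le c hc m (fun x => ih s (Set.Ico_subset_Icc_self hs) x) x) ht
  have hlim : Tendsto (fun k : ℕ => C * ((K * T) ^ k / k.factorial)) atTop (𝓝 (C * 0)) :=
    (FloorSemiring.tendsto_pow_div_factorial_atTop (K * T)).const_mul C
  rw [mul_zero] at hlim
  have := ge_of_tendsto' hlim fun k => key k T ⟨hT, le_rfl⟩ x
  exact abs_eq_zero.1 (le_antisymm this (abs_nonneg _))

theorem SolvesBackward.eq {c : ι → ℝ} (hc : ∀ i, 0 ≤ c i) {m : ι → S → S} {f g : ℝ → S → ℝ}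
    (hf : SolvesBackward c m f) (hg : SolvesBackward c m g) (h0 : ∀ x, f 0 x = g 0 x) {T : ℝ}
    (hT : 0 ≤ T) (x : S) : f T x = g T x :=
  sub_eq_zero.1 ((hf.sub hg).eq_zero hc (fun x => sub_eq_zero.2 (h0 x)) hT x)

end Generator

namespace IsTransitionFunction

variable {S : Type*} {q : S → S → ℝ} {P : ℝ≥0 → S → S → ℝ}

theorem le_one (hP : IsTransitionFunction q P) (t : ℝ≥0) (x y : S) : P t x y ≤ 1 :=
  le_hasSum (hP.sum_eq_one t x) y fun z _ => hP.nonneg t x z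

theorem abs_sub_sum_le (hP : IsTransitionFunction q P) (h s : ℝ≥0) (x y : S) (F : Finset S) :
    |P (h + s) x y - ∑ z ∈ F, P h x z * P s z y| ≤ 1 - ∑ z ∈ F, P h x z := by
  have h1 := sum_le_hasSum F (fun z _ => mul_nonneg (hP.nonneg h x z) (hP.nonneg s z y))
    (hP.chapman_kolmogorov h s x y)
  have h2 := sum_le_hasSum F
    (fun z _ => by nlinarith [hP.nonneg h x z, hP.le_one s z y])
    ((hP.sum_eq_one h x).sub (hP.chapman_kolmogorov h s x y))
  rw [Finset.sum_sub_distrib] at h2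
  rw [abs_of_nonneg (by linarith)]
  linarith

theorem tendsto_self (hP : IsTransitionFunction q P) (x : S) :
    Tendsto (fun h => P h x x) (𝓝 0) (𝓝 1) := by
  have h0 : P 0 x x = 1 := by simp [hP.zero]
  have hcoe : Tendsto (fun h : ℝ≥0 => (h : ℝ)) (𝓝[>] 0) (𝓝 0) :=
    (NNReal.continuous_coe.tendsto' 0 0 rfl).mono_left nhdsWithin_le_nhds
  have h1 : ContinuousWithinAt (fun h => P h x x) (Set.Ioi 0) 0 := by
    have := ((hP.rates x x).mul hcoe).add_const (P 0 x x)
    rw [mul_zero, zero_add] at this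
    refine this.congr' ?_
    filter_upwards [self_mem_nhdsWithin] with h hh
    have : (h : ℝ) ≠ 0 := (NNReal.coe_pos.2 hh).ne'
    field_simp
    ring
  rw [continuousWithinAt_Ioi_iff_Ici] at h1
  rw [← h0]
  simpa [ContinuousWithinAt] using h1

end IsTransitionFunction

section ExpOp

variable {E : Type*} [NormedAddCommGroup E] [NormedSpace ℝ E]

/-- The one-parameter group `exp (t A) f` generated by a bounded operator `A`. -/
def expOp (A : E →L[ℝ] E) (t : ℝ) (f : E) : E := NormedSpace.exp (t • A) f

theorem expOp_zero (A : E →L[ℝ] E) (f : E) : expOp A 0 f = f := by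
  simp [expOp]

theorem expOp_smul (A : E →L[ℝ] E) (t a : ℝ) (f : E) : expOp A t (a • f) = a • expOp A t f :=
  map_smul _ _ _

variable [CompleteSpace E]

theorem expOp_add (A : E →L[ℝ] E) (s t : ℝ) (f : E) :
    expOp A (s + t) f = expOp A s (expOp A t f) := by
  let : NormedAlgebra ℚ (E →L[ℝ] E) := NormedAlgebra.restrictScalars ℚ ℝ _
  have h : NormedSpace.exp ((s + t) • A) = NormedSpace.exp (s • A) * NormedSpace.exp (t • A) := by
    rw [add_smul]
    exact NormedSpace.exp_add_of_commute (((Commute.refl _).smul_left s).smul_right t)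
  rw [expOp, h]
  rfl

theorem hasDerivAt_expOp (A : E →L[ℝ] E) (f : E) (t : ℝ) :
    HasDerivAt (fun t => expOp A t f) (A (expOp A t f)) t :=
  (ContinuousLinearMap.apply ℝ E f).hasFDerivAt.comp_hasDerivAt t
    (hasDerivAt_exp_smul_const' (𝕂 := ℝ) A t)

theorem hasSum_expOp (A : E →L[ℝ] E) (t : ℝ) (f : E) :
    HasSum (fun k : ℕ => (t ^ k / k.factorial) • (A ^ k) f) (expOp A t f) := by
  have h : HasSum (fun k : ℕ => ((k.factorial : ℝ)⁻¹) • (t • A) ^ k)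
      (NormedSpace.exp (t • A)) := NormedSpace.exp_series_hasSum_exp' _
  refine ((ContinuousLinearMap.apply ℝ E f).hasSum h).congr_fun fun k => ?_
  simp only [smul_pow, smul_smul, div_eq_inv_mul]
  rfl

end ExpOp

section Semigroup

variable {S ι : Type*} [Fintype ι] [TopologicalSpace S] [DiscreteTopology S]

open BoundedContinuousFunction

/-- The operator `f ↦ ∑ i, c i * f (m i x)` on bounded functions. -/
def moveOp (c : ι → ℝ) (m : ι → S → S) : (S →ᵇ ℝ) →L[ℝ] (S →ᵇ ℝ) :=
  ∑ i, c i • compContinuousCLM ℝ ℝ ⟨m i, continuous_of_discreteTopology⟩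

theorem moveOp_apply (c : ι → ℝ) (m : ι → S → S) (f : S →ᵇ ℝ) (x : S) :
    moveOp c m f x = ∑ i, c i * f (m i x) := by
  simp [moveOp]

/-- The semigroup generated by `gen c m`, acting on bounded functions. -/
def semigroup (c : ι → ℝ) (m : ι → S → S) (t : ℝ) (f : S →ᵇ ℝ) : S →ᵇ ℝ :=
  Real.exp (-(∑ i, c i) * t) • expOp (moveOp c m) t f

theorem semigroup_zero (c : ι → ℝ) (m : ι → S → S) (f : S →ᵇ ℝ) : semigroup c m 0 f = f := by
  simp [semigroup, expOp_zero]

theorem semigroup_add (c : ι → ℝ) (m : ι → S → S) (s t : ℝ) (f : S →ᵇ ℝ) :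
    semigroup c m (s + t) f = semigroup c m s (semigroup c m t f) := by
  simp only [semigroup, expOp_add, mul_add, Real.exp_add, expOp_smul, smul_smul]

theorem hasDerivAt_semigroup (c : ι → ℝ) (m : ι → S → S) (f : S →ᵇ ℝ) (t : ℝ) (x : S) :
    HasDerivAt (fun t => semigroup c m t f x) (gen c m (semigroup c m t f) x) t := by
  have h2 : HasDerivAt (fun t : ℝ => expOp (moveOp c m) t f x)
      (moveOp c m (expOp (moveOp c m) t f) x) t :=
    (evalCLM (β := ℝ) ℝ x : (S →ᵇ ℝ) →L[ℝ] ℝ).hasFDerivAt.comp_hasDerivAt t (hasDerivAt_expOp (moveOp c m) f t)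
  have h3 : HasDerivAt (fun t : ℝ => Real.exp (-(∑ i, c i) * t))
      (Real.exp (-(∑ i, c i) * t) * (-(∑ i, c i))) t := by
    simpa using ((hasDerivAt_id t).const_mul (-(∑ i, c i))).exp
  refine (h3.mul h2).congr_deriv ?_
  rw [moveOp_apply, gen]
  simp only [semigroup, coe_smul, smul_eq_mul, mul_sub, Finset.sum_sub_distrib,
    ← Finset.sum_mul, Finset.mul_sum]
  simp only [mul_left_comm (c _)]
  ring

theorem solvesBackward_semigroup (c : ι → ℝ) (m : ι → S → S) (f : S →ᵇ ℝ) :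
    SolvesBackward c m (fun t => semigroup c m t f) where
  continuousOn x t _ := (hasDerivAt_semigroup c m f t x).continuousAt.continuousWithinAt
  hasDeriv t _ x := (hasDerivAt_semigroup c m f t x).hasDerivWithinAt
  bounded T := by
    have hcont : Continuous fun t : ℝ => semigroup c m t f := by
      refine continuous_iff_continuousAt.2 fun t => ?_
      have h : ContinuousAt (fun t => Real.exp (-(∑ i, c i) * t)) t := by fun_prop
      exact h.smul (hasDerivAt_expOp (moveOp c m) f t).continuousAt
    obtain ⟨C, hC⟩ := isCompact_Icc.exists_bound_of_continuousOn (s := Set.Icc 0 T)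
      hcont.continuousOn
    exact ⟨C, fun t ht x => (norm_coe_le_norm _ x).trans (hC t ht)⟩

theorem hasSum_semigroup (c : ι → ℝ) (m : ι → S → S) (t : ℝ) (f : S →ᵇ ℝ) (x : S) :
    HasSum (fun k : ℕ => Real.exp (-(∑ i, c i) * t) * (t ^ k / k.factorial) *
      (moveOp c m ^ k) f x) (semigroup c m t f x) := by
  refine (((evalCLM (β := ℝ) ℝ x : (S →ᵇ ℝ) →L[ℝ] ℝ).hasSum
    (hasSum_expOp (moveOp c m) t f)).mul_left (Real.exp (-(∑ i, c i) * t))).congr_fun fun k => ?_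
  rw [mul_assoc]
  rfl

open Classical in
/-- The indicator function of a point. -/
def dirac (y : S) : S →ᵇ ℝ :=
  ofNormedAddCommGroup (fun x => if x = y then 1 else 0) continuous_of_discreteTopology 1
    (fun x => by split_ifs <;> simp)

open Classical in
theorem dirac_apply (x y : S) : dirac y x = if x = y then (1 : ℝ) else 0 := by
  simp [dirac]

theorem moveOp_pow_succ_apply (c : ι → ℝ) (m : ι → S → S) (k : ℕ)
    (f : S →ᵇ ℝ) (x : S) :
    (moveOp c m ^ (k + 1)) f x = ∑ i, c i * (moveOp c m ^ k) f (m i x) := by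
  rw [pow_succ', ← moveOp_apply]
  rfl

theorem moveOp_pow_nonneg (c : ι → ℝ) (hc : ∀ i, 0 ≤ c i) (m : ι → S → S) (k : ℕ)
    (f : S →ᵇ ℝ) (hf : ∀ x, 0 ≤ f x) (x : S) :
    0 ≤ (moveOp c m ^ k) f x := by
  induction k generalizing x with
  | zero => simpa using hf x
  | succ k ih =>
    rw [moveOp_pow_succ_apply]
    exact Finset.sum_nonneg fun i _ => mul_nonneg (hc i) (ih _)

theorem hasSum_moveOp_pow (c : ι → ℝ) (m : ι → S → S) (k : ℕ)
    (f : S →ᵇ ℝ) (x : S) :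
    HasSum (fun z => (moveOp c m ^ k) (dirac z) x * f z) ((moveOp c m ^ k) f x) := by
  induction k generalizing x with
  | zero =>
    classical
    refine (hasSum_ite_eq x (f x)).congr_fun ?_
    intro z
    rw [pow_zero, one_apply_eq_self, dirac_apply]
    by_cases h : x = z <;> simp [h, eq_comm]
  | succ k ih =>
    simp only [moveOp_pow_succ_apply, Finset.sum_mul, mul_assoc]
    exact hasSum_sum fun i _ => (ih (m i x)).mul_left (c i)

theorem semigroup_nonneg (c : ι → ℝ) (hc : ∀ i, 0 ≤ c i) (m : ι → S → S) {t : ℝ} (ht : 0 ≤ t)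
    (f : S →ᵇ ℝ) (hf : ∀ x, 0 ≤ f x) (x : S) :
    0 ≤ semigroup c m t f x :=
  (hasSum_semigroup c m t f x).nonneg fun k =>
    mul_nonneg (by positivity) (moveOp_pow_nonneg c hc m k f hf x)

theorem hasSum_semigroup_dirac (c : ι → ℝ) (hc : ∀ i, 0 ≤ c i) (m : ι → S → S) {t : ℝ}
    (ht : 0 ≤ t) (f : S →ᵇ ℝ) (x : S) :
    HasSum (fun z => semigroup c m t (dirac z) x * f z) (semigroup c m t f x) := by
  set w : ℕ → ℝ := fun k => Real.exp (-(∑ i, c i) * t) * (t ^ k / k.factorial) with hw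
  have hw0 : ∀ k, 0 ≤ w k := fun k => by positivity
  set F : ℕ × S → ℝ := fun p => w p.1 * ((moveOp c m ^ p.1) (dirac p.2) x * f p.2) with hF
  have hrow : ∀ k, HasSum (fun z => F (k, z)) (w k * (moveOp c m ^ k) f x) :=
    fun k => (hasSum_moveOp_pow c m k f x).mul_left (w k)
  have hd0 : ∀ k z, 0 ≤ (moveOp c m ^ k) (dirac z) x := fun k z =>
    moveOp_pow_nonneg c hc m k _ (fun x => by rw [dirac_apply]; split_ifs <;> norm_num) x
  have hsum : Summable F := by
    refine Summable.of_norm ?_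
    have hnorm : ∀ k, HasSum (fun z => ‖F (k, z)‖) (w k * (moveOp c m ^ k) |f| x) := by
      intro k
      refine ((hasSum_moveOp_pow c m k |f| x).mul_left (w k)).congr_fun fun z => ?_
      change |w k * ((moveOp c m ^ k) (dirac z) x * f z)| = _
      rw [abs_mul, abs_of_nonneg (hw0 k), abs_mul, abs_of_nonneg (hd0 k z)]
      rfl
    refine (summable_prod_of_nonneg fun p => norm_nonneg _).2 ⟨fun k => (hnorm k).summable, ?_⟩
    simp only [fun k => (hnorm k).tsum_eq]
    exact (hasSum_semigroup c m t |f| x).summable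
  have htot : HasSum F (semigroup c m t f x) := by
    convert hsum.hasSum using 1
    exact ((hasSum_semigroup c m t f x).unique (hsum.hasSum.prod_fiberwise hrow))
  refine HasSum.prod_fiberwise (f := fun p : S × ℕ => F p.swap)
    ((Equiv.prodComm S ℕ).hasSum_iff.2 htot) fun z => ?_
  refine ((hasSum_semigroup c m t (dirac z) x).mul_right (f z)).congr_fun fun k => ?_
  simp [hF, hw, mul_assoc]

theorem isTransitionFunction_semigroup (c : ι → ℝ) (hc : ∀ i, 0 ≤ c i) (m : ι → S → S)
    (q : S → S → ℝ) (hq : ∀ x z, qMatrix q x z = gen c m (dirac z) x) :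
    IsTransitionFunction q (fun t x y => semigroup c m t (dirac y) x) where
  nonneg t x y := semigroup_nonneg c hc m t.2 _
    (fun x => by rw [dirac_apply]; split_ifs <;> norm_num) x
  sum_eq_one t x := by
    have h1 : semigroup c m t 1 x = 1 := by
      refine (solvesBackward_semigroup c m 1).eq (g := fun _ _ => 1) hc ⟨?_, ?_, ?_⟩ ?_ t.2 x
      · exact fun x => continuousOn_const
      · exact fun t _ x => by simpa [gen] using hasDerivWithinAt_const t (Set.Ici t) (1 : ℝ)
      · exact fun T => ⟨1, fun t _ x => by simp⟩
      · simp [semigroup_zero]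
    simpa [h1] using hasSum_semigroup_dirac c hc m t.2 1 x
  zero x y := by
    classical
    simp [semigroup_zero, dirac_apply]
  chapman_kolmogorov s t x y := by
    simp only [NNReal.coe_add, semigroup_add]
    exact hasSum_semigroup_dirac c hc m s.2 _ x
  rates x y := by
    have h := (hasDerivAt_semigroup c m (dirac y) 0 x).hasDerivWithinAt (s := Set.Ioi 0)
    rw [semigroup_zero, ← hq,
      hasDerivWithinAt_iff_tendsto_slope' (by simp)] at h
    have hcoe : Tendsto (fun h : ℝ≥0 => (h : ℝ)) (𝓝[>] 0) (𝓝[>] 0) := by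
      refine tendsto_nhdsWithin_iff.2 ⟨?_, ?_⟩
      · exact (NNReal.continuous_coe.tendsto' 0 0 rfl).mono_left nhdsWithin_le_nhds
      · filter_upwards [self_mem_nhdsWithin] with h hh using NNReal.coe_pos.2 hh
    refine (h.comp hcoe).congr fun h => ?_
    simp [slope_def_field]

theorem sum_gen_dirac_mul (c : ι → ℝ) (m : ι → S → S) (x : S) (F : Finset S) (hx : x ∈ F)
    (hm : ∀ i, m i x ∈ F) (f : S → ℝ) :
    ∑ z ∈ F, gen c m (dirac z) x * f z = gen c m f x := by
  classical
  have h : ∀ w ∈ F, ∑ z ∈ F, dirac z w * f z = f w := by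
    intro w hw
    simp [dirac_apply, hw]
  simp only [gen, Finset.sum_mul]
  rw [Finset.sum_comm]
  refine Finset.sum_congr rfl fun i _ => ?_
  simp only [mul_assoc, sub_mul, ← Finset.mul_sum, Finset.sum_sub_distrib]
  rw [h _ (hm i), h _ hx]

namespace IsTransitionFunction

variable {q : S → S → ℝ} {P : ℝ≥0 → S → S → ℝ}

theorem tendsto_slope (hP : IsTransitionFunction q P) {c : ι → ℝ} {m : ι → S → S}
    (hq : ∀ x z, qMatrix q x z = gen c m (dirac z) x) (s : ℝ≥0) (x y : S) :
    Tendsto (fun h : ℝ≥0 => (P (h + s) x y - P s x y) / (h : ℝ)) (𝓝[>] 0)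
      (𝓝 (gen c m (fun z => P s z y) x)) := by
  classical
  set F : Finset S := insert x (Finset.univ.image fun i => m i x) with hF
  have hx : x ∈ F := by simp [hF]
  have hm : ∀ i, m i x ∈ F := fun i => by simp [hF]
  have hmain : Tendsto (fun h : ℝ≥0 => ∑ z ∈ F, (P h x z - P 0 x z) / (h : ℝ) * P s z y)
      (𝓝[>] 0) (𝓝 (gen c m (fun z => P s z y) x)) := by
    rw [← sum_gen_dirac_mul c m x F hx hm]
    refine tendsto_finsetSum _ fun z _ => ?_
    rw [← hq]
    exact (hP.rates x z).mul_const _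
  have herr : Tendsto (fun h : ℝ≥0 => -∑ z ∈ F, (P h x z - P 0 x z) / (h : ℝ))
      (𝓝[>] 0) (𝓝 0) := by
    have h1 : (0 : ℝ) = -∑ z ∈ F, qMatrix q x z := by
      have := sum_gen_dirac_mul c m x F hx hm (fun _ => 1)
      simp only [mul_one, ← hq] at this
      simp [this, gen]
    rw [h1]
    exact (tendsto_finsetSum _ fun z _ => hP.rates x z).neg
  have h0 : ∀ f : S → ℝ, ∑ z ∈ F, P 0 x z * f z = f x := by
    intro f
    simp [hP.zero, hx]
  have hsub : Tendsto (fun h : ℝ≥0 => (P (h + s) x y - P s x y) / (h : ℝ) -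
      ∑ z ∈ F, (P h x z - P 0 x z) / (h : ℝ) * P s z y) (𝓝[>] 0) (𝓝 0) := by
    refine squeeze_zero_norm' ?_ herr
    filter_upwards [self_mem_nhdsWithin] with h hh
    have hh' : (0 : ℝ) < h := NNReal.coe_pos.2 hh
    have e1 : ∑ z ∈ F, (P h x z - P 0 x z) / (h : ℝ) * P s z y =
        (∑ z ∈ F, P h x z * P s z y - P s x y) / h := by
      rw [← h0 fun z => P s z y, ← Finset.sum_sub_distrib, Finset.sum_div]
      exact Finset.sum_congr rfl fun z _ => by ring
    have e2 : -∑ z ∈ F, (P h x z - P 0 x z) / (h : ℝ) = (1 - ∑ z ∈ F, P h x z) / h := by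
      have := h0 fun _ => 1
      simp only [mul_one] at this
      rw [← this, ← Finset.sum_sub_distrib, Finset.sum_div, ← Finset.sum_neg_distrib]
      exact Finset.sum_congr rfl fun z _ => by ring
    rw [e1, e2, ← sub_div, sub_sub_sub_cancel_right, Real.norm_eq_abs, abs_div, abs_of_pos hh']
    exact div_le_div_of_nonneg_right (hP.abs_sub_sum_le h s x y F) hh'.le
  simpa using hsub.add hmain

theorem solvesBackward (hP : IsTransitionFunction q P) {c : ι → ℝ} {m : ι → S → S}
    (hq : ∀ x z, qMatrix q x z = gen c m (dirac z) x) (y : S) :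
    SolvesBackward c m (fun t x => P t.toNNReal x y) where
  continuousOn x := by
    have hle : ∀ h s : ℝ≥0, |P (h + s) x y - P s x y| ≤ 2 * (1 - P h x x) := by
      intro h s
      have h1 := abs_le.1 (hP.abs_sub_sum_le h s x y {x})
      simp only [Finset.sum_singleton] at h1
      have := hP.le_one h x x
      rw [abs_le]
      constructor <;> nlinarith [hP.nonneg s x y, hP.le_one s x y]
    have hdist : ∀ s t : ℝ, 0 ≤ s → 0 ≤ t →
        |P t.toNNReal x y - P s.toNNReal x y| ≤ 2 * (1 - P |t - s|.toNNReal x x) := by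
      intro s t hs ht
      wlog hst : s ≤ t generalizing s t
      · rw [abs_sub_comm, abs_sub_comm t s]
        exact this t s ht hs (le_of_not_ge hst)
      have := hle |t - s|.toNNReal s.toNNReal
      rwa [← Real.toNNReal_add (abs_nonneg _) hs, abs_of_nonneg (sub_nonneg.2 hst),
        sub_add_cancel, ← abs_of_nonneg (sub_nonneg.2 hst)] at this
    intro s hs
    rw [ContinuousWithinAt, tendsto_iff_norm_sub_tendsto_zero]
    have hlim : Tendsto (fun t : ℝ => 2 * (1 - P |t - s|.toNNReal x x)) (𝓝[Set.Ici 0] s) (𝓝 0) := by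
      have hcont : Continuous fun t : ℝ => |t - s|.toNNReal := by fun_prop
      have h := (hP.tendsto_self x).comp
        ((hcont.tendsto' s 0 (by simp)).mono_left (nhdsWithin_le_nhds (s := Set.Ici 0)))
      simpa using (h.const_sub 1).const_mul 2
    refine squeeze_zero' (Eventually.of_forall fun t => norm_nonneg _) ?_ hlim
    filter_upwards [self_mem_nhdsWithin] with t ht using hdist s t hs ht
  hasDeriv t ht x := by
    rw [← hasDerivWithinAt_Ioi_iff_Ici, hasDerivWithinAt_iff_tendsto_slope' (by simp)]
    have htend : Tendsto (fun u : ℝ => (u - t).toNNReal) (𝓝[>] t) (𝓝[>] 0) := by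
      refine tendsto_nhdsWithin_iff.2 ⟨?_, ?_⟩
      · have : Continuous fun u : ℝ => (u - t).toNNReal := by fun_prop
        exact (this.tendsto' t 0 (by simp)).mono_left nhdsWithin_le_nhds
      · filter_upwards [self_mem_nhdsWithin] with u hu
        simpa using hu
    refine ((hP.tendsto_slope hq t.toNNReal x y).comp htend).congr' ?_
    filter_upwards [self_mem_nhdsWithin] with u hu
    have hu' : t < u := hu
    rw [slope_def_field, Function.comp_apply, ← Real.toNNReal_add (by linarith) ht,
      Real.coe_toNNReal _ (by linarith), sub_add_cancel]
  bounded T := ⟨1, fun t _ x => by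
    rw [abs_of_nonneg (hP.nonneg _ _ _)]
    exact hP.le_one _ _ _⟩

/-- The transition function of a bounded generator is unique. -/
theorem eq_semigroup (hP : IsTransitionFunction q P) {c : ι → ℝ} (hc : ∀ i, 0 ≤ c i)
    {m : ι → S → S} (hq : ∀ x z, qMatrix q x z = gen c m (dirac z) x) (t : ℝ≥0) (x y : S) :
    P t x y = semigroup c m t (dirac y) x := by
  classical
  have h := (hP.solvesBackward hq y).eq hc (solvesBackward_semigroup c m (dirac y))
    (fun x => by simp [hP.zero, semigroup_zero, dirac_apply]) t.2 x
  simpa using h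

end IsTransitionFunction

end Semigroup

section LaurentCoefficients

/-- The coefficient of `z ^ (-m)` in the Laurent series of `exp (t * (z + 1 / z))`. -/
def laurentCoeff (t : ℝ) (m : ℤ) : ℂ :=
  (2 * Real.pi * Complex.I)⁻¹ •
    ∮ z in C(0, 1), (z - 0)⁻¹ • (z ^ m * Complex.exp (t * (z + 1 / z)))

theorem continuousOn_laurent (t : ℝ) (m : ℤ) :
    ContinuousOn (fun z : ℂ => z ^ m * Complex.exp (t * (z + 1 / z))) {0}ᶜ := by
  intro z hz
  have hz : z ≠ 0 := hz
  refine ContinuousAt.continuousWithinAt ?_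
  exact (continuousAt_zpow₀ z m (Or.inl hz)).mul
    (ContinuousAt.cexp (by fun_prop (disch := exact hz)))

theorem differentiableAt_laurent (t : ℝ) (m : ℤ) {z : ℂ} (hz : z ≠ 0) :
    DifferentiableAt ℂ (fun z : ℂ => z ^ m * Complex.exp (t * (z + 1 / z))) z :=
  (differentiableAt_zpow.2 (Or.inl hz)).mul
    (DifferentiableAt.cexp (by fun_prop (disch := exact hz)))

theorem laurentCoeff_eq_of_pos (t : ℝ) (m : ℤ) {ρ : ℝ} (hρ : 0 < ρ) :
    laurentCoeff t m = (2 * Real.pi * Complex.I)⁻¹ •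
      ∮ z in C(0, ρ), (z - 0)⁻¹ • (z ^ m * Complex.exp (t * (z + 1 / z))) := by
  have key : ∀ {a b : ℝ}, 0 < a → a ≤ b →
      (∮ z in C(0, b), (z - 0)⁻¹ • (z ^ m * Complex.exp (t * (z + 1 / z)))) =
      ∮ z in C(0, a), (z - 0)⁻¹ • (z ^ m * Complex.exp (t * (z + 1 / z))) := by
    intro a b ha hab
    refine Complex.circleIntegral_sub_center_inv_smul_eq_of_differentiable_on_annulus_off_countable
      ha hab Set.countable_empty ((continuousOn_laurent t m).mono ?_) ?_
    · rintro z ⟨-, hz⟩ rfl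
      exact hz (Metric.mem_ball_self ha)
    · rintro z ⟨⟨-, hz⟩, -⟩
      refine differentiableAt_laurent t m ?_
      rintro rfl
      exact hz (Metric.mem_closedBall_self ha.le)
  rcases le_total ρ 1 with h | h
  · rw [laurentCoeff, key hρ h]
  · rw [laurentCoeff, key one_pos h]

theorem norm_laurentCoeff_le (t : ℝ) (m : ℤ) {ρ : ℝ} (hρ : 0 < ρ) :
    ‖laurentCoeff t m‖ ≤ ρ ^ m * Real.exp (|t| * (ρ + ρ⁻¹)) := by
  rw [laurentCoeff_eq_of_pos t m hρ]
  have : ρ ^ m * Real.exp (|t| * (ρ + ρ⁻¹)) =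
      ρ * (ρ⁻¹ * (ρ ^ m * Real.exp (|t| * (ρ + ρ⁻¹)))) := by field_simp
  rw [this]
  refine circleIntegral.norm_two_pi_i_inv_smul_integral_le_of_norm_le_const hρ.le fun z hz => ?_
  have hz : ‖z‖ = ρ := by simpa using hz
  rw [norm_smul, norm_mul, sub_zero, norm_inv, norm_zpow, hz, Complex.norm_exp]
  gcongr
  refine (Complex.re_le_norm _).trans ?_
  rw [norm_mul, Complex.norm_real, Real.norm_eq_abs]
  gcongr
  refine (norm_add_le _ _).trans ?_
  simp [hz]

theorem laurentCoeff_eq_interval (t : ℝ) (m : ℤ) :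
    laurentCoeff t m = (2 * Real.pi * Complex.I)⁻¹ • ∫ θ in (0 : ℝ)..2 * Real.pi,
      Complex.I * (circleMap 0 1 θ ^ m *
        Complex.exp (t * (circleMap 0 1 θ + 1 / circleMap 0 1 θ))) := by
  rw [laurentCoeff, circleIntegral]
  congr 1
  refine intervalIntegral.integral_congr fun θ _ => ?_
  have hz : circleMap 0 1 θ ≠ 0 := circleMap_ne_center one_ne_zero
  simp only [deriv_circleMap, smul_eq_mul, sub_zero]
  field_simp

theorem hasDerivAt_laurentCoeff (t : ℝ) (m : ℤ) :
    HasDerivAt (fun t => laurentCoeff t m) (laurentCoeff t (m + 1) + laurentCoeff t (m - 1)) t := by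
  have hz : ∀ θ, circleMap 0 1 θ ≠ 0 := fun θ => circleMap_ne_center one_ne_zero
  have hcont : ∀ (s : ℝ) (k : ℤ), Continuous fun θ : ℝ => Complex.I * (circleMap 0 1 θ ^ k *
      Complex.exp (s * (circleMap 0 1 θ + 1 / circleMap 0 1 θ))) := by
    intro s k
    exact continuous_const.mul ((continuousOn_laurent s k).comp_continuous
      (continuous_circleMap 0 1) hz)
  have hd := (intervalIntegral.hasDerivAt_integral_of_dominated_loc_of_deriv_le
    (μ := volume) (a := 0) (b := 2 * Real.pi) (x₀ := t) (s := Metric.ball t 1)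
    (F := fun (s : ℝ) θ => Complex.I * (circleMap 0 1 θ ^ m *
      Complex.exp (s * (circleMap 0 1 θ + 1 / circleMap 0 1 θ))))
    (F' := fun (s : ℝ) θ => Complex.I * (circleMap 0 1 θ ^ (m + 1) *
        Complex.exp (s * (circleMap 0 1 θ + 1 / circleMap 0 1 θ))) +
      Complex.I * (circleMap 0 1 θ ^ (m - 1) *
        Complex.exp (s * (circleMap 0 1 θ + 1 / circleMap 0 1 θ))))
    (bound := fun _ => 2 * Real.exp ((|t| + 1) * 2)) (Metric.ball_mem_nhds t one_pos)
    (Eventually.of_forall fun s => (hcont s m).aestronglyMeasurable)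
    ((hcont t m).intervalIntegrable _ _)
    ((hcont t (m + 1)).add (hcont t (m - 1))).aestronglyMeasurable
    (ae_of_all _ fun θ _ s hs => ?_) (by simp)
    (ae_of_all _ fun θ _ s _ => ?_)).2
  · rw [intervalIntegral.integral_add ((hcont t (m + 1)).intervalIntegrable _ _)
      ((hcont t (m - 1)).intervalIntegrable _ _)] at hd
    simp only [laurentCoeff_eq_interval, ← smul_add]
    exact hd.const_smul ((2 * Real.pi * Complex.I : ℂ)⁻¹)
  · have hs' : |s| ≤ |t| + 1 := by
      rw [Metric.mem_ball, Real.dist_eq] at hs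
      linarith [abs_sub_abs_le_abs_sub s t]
    have hn : ∀ k : ℤ, ‖Complex.I * (circleMap 0 1 θ ^ k *
        Complex.exp (s * (circleMap 0 1 θ + 1 / circleMap 0 1 θ)))‖ ≤
        Real.exp ((|t| + 1) * 2) := by
      intro k
      have h1 : ‖circleMap 0 1 θ‖ = 1 := by simp [circleMap]
      rw [norm_mul, norm_mul, norm_zpow, h1, Complex.norm_I, one_zpow, one_mul, one_mul,
        Complex.norm_exp]
      gcongr
      refine (Complex.re_le_norm _).trans ?_
      rw [norm_mul, Complex.norm_real, Real.norm_eq_abs]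
      gcongr
      refine (norm_add_le _ _).trans ?_
      rw [norm_div, h1]
      norm_num
    exact (norm_add_le _ _).trans (by linarith [hn (m + 1), hn (m - 1)])
  · have h1 : HasDerivAt (fun s : ℝ => (s : ℂ) * (circleMap 0 1 θ + 1 / circleMap 0 1 θ))
        (circleMap 0 1 θ + 1 / circleMap 0 1 θ) s := by
      simpa using (Complex.ofRealCLM.hasDerivAt (x := s)).mul_const _
    refine ((h1.cexp.const_mul (circleMap 0 1 θ ^ m)).const_mul Complex.I).congr_deriv ?_
    rw [zpow_add_one₀ (hz θ), zpow_sub_one₀ (hz θ)]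
    field_simp

theorem laurentCoeff_zero (m : ℤ) : laurentCoeff 0 m = if m = 0 then 1 else 0 := by
  have h : laurentCoeff 0 m =
      (2 * Real.pi * Complex.I)⁻¹ • ∮ z in C(0, 1), (z - (0 : ℂ)) ^ (m - 1) := by
    rw [laurentCoeff]
    congr 1
    refine circleIntegral.integral_congr zero_le_one fun z hz => ?_
    have hz : z ≠ 0 := by rintro rfl; simp at hz
    simp [zpow_sub_one₀ hz, mul_comm]
  rw [h]
  split_ifs with hm
  · subst hm
    simp only [zero_sub, zpow_neg_one]
    rw [circleIntegral.integral_sub_center_inv 0 one_ne_zero, smul_eq_mul]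
    exact inv_mul_cancel₀ Complex.two_pi_I_ne_zero
  · rw [circleIntegral.integral_sub_zpow_of_ne (by omega), smul_zero]

theorem psi_eq_laurentCoeff (t : ℝ) (x y : ℤ) :
    psi t x y = (laurentCoeff t (y - x)).re - (laurentCoeff t (x + y + 2)).re := by
  rw [psi, ← Complex.sub_re]
  congr 1
  have hint : ∀ k : ℤ, CircleIntegrable
      (fun z : ℂ => (z - 0)⁻¹ • (z ^ k * Complex.exp (t * (z + 1 / z)))) 0 1 := by
    intro k
    have h0 : ∀ z ∈ Metric.sphere (0 : ℂ) 1, z ≠ 0 := by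
      rintro z hz rfl
      simp at hz
    refine ContinuousOn.circleIntegrable zero_le_one ?_
    have h1 : ContinuousOn (fun z : ℂ => z - 0) (Metric.sphere 0 1) := by fun_prop
    exact ContinuousOn.smul (h1.inv₀ fun z hz => by simpa using h0 z hz)
      ((continuousOn_laurent t k).mono h0)
  rw [laurentCoeff, laurentCoeff, ← smul_sub, ← circleIntegral.integral_sub (hint _) (hint _),
    psiC, smul_eq_mul]
  congr 2
  ext z
  simp only [smul_eq_mul, sub_zero]
  ring

theorem psi_neg_one (t : ℝ) (y : ℤ) : psi t (-1) y = 0 := by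
  rw [psi_eq_laurentCoeff, show y - -1 = -1 + y + 2 by ring, sub_self]

theorem psi_zero {x y : ℤ} (hx : 0 ≤ x) (hy : -1 ≤ y) : psi 0 x y = if y - x = 0 then 1 else 0 := by
  rw [psi_eq_laurentCoeff, laurentCoeff_zero, laurentCoeff_zero, if_neg (show ¬x + y + 2 = 0 by omega)]
  split_ifs <;> simp

end LaurentCoefficients

section HeatSolution

/-- `f t u` solves the discrete heat equation `∂ₜ f(u) = f(u+1) + f(u-1)` and decays faster than
every exponential as `u → ∞`. -/
structure HeatSolution (f : ℝ → ℤ → ℝ) : Prop where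
  hasDeriv : ∀ t u, HasDerivAt (fun t => f t u) (f t (u + 1) + f t (u - 1)) t
  bound : ∀ T, ∀ᶠ R : ℝ in atTop, ∃ C, ∀ t, |t| ≤ T → ∀ u : ℤ, |f t u| ≤ C * R ^ (-u)

theorem heatSolution_psi (w : ℤ) : HeatSolution (fun t u => psi t u w) where
  hasDeriv t u := by
    simp only [psi_eq_laurentCoeff]
    have h := ((Complex.reCLM.hasFDerivAt.comp_hasDerivAt t
      (hasDerivAt_laurentCoeff t (w - u))).sub (Complex.reCLM.hasFDerivAt.comp_hasDerivAt t
      (hasDerivAt_laurentCoeff t (u + w + 2))))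
    refine h.congr_deriv ?_
    simp only [Complex.reCLM_apply, Complex.add_re]
    rw [show w - (u + 1) = w - u - 1 by ring, show w - (u - 1) = w - u + 1 by ring,
      show u + 1 + w + 2 = u + w + 2 + 1 by ring, show u - 1 + w + 2 = u + w + 2 - 1 by ring]
    ring
  bound T := by
    filter_upwards [eventually_gt_atTop 0] with R hR
    refine ⟨(R ^ w + R ^ (-w - 2)) * Real.exp (T * (R + R⁻¹)), fun t ht u => ?_⟩
    rw [psi_eq_laurentCoeff]
    have h1 := (Complex.abs_re_le_norm _).trans (norm_laurentCoeff_le t (w - u) hR)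
    have h2 := (Complex.abs_re_le_norm _).trans
      (norm_laurentCoeff_le t (u + w + 2) (inv_pos.2 hR))
    have h3 : Real.exp (|t| * (R + R⁻¹)) ≤ Real.exp (T * (R + R⁻¹)) := by gcongr
    rw [inv_inv, add_comm R⁻¹ R, inv_zpow', show -(u + w + 2) = -w - 2 + -u by ring,
      zpow_add₀ hR.ne'] at h2
    rw [sub_eq_add_neg, zpow_add₀ hR.ne'] at h1
    calc _ ≤ _ := abs_sub _ _
      _ ≤ _ := add_le_add h1 h2
      _ = (R ^ w + R ^ (-w - 2)) * R ^ (-u) * Real.exp (|t| * (R + R⁻¹)) := by ring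
      _ ≤ (R ^ w + R ^ (-w - 2)) * R ^ (-u) * Real.exp (T * (R + R⁻¹)) := by gcongr
      _ = _ := by ring

namespace HeatSolution

variable {f g h : ℝ → ℤ → ℝ}

theorem sub_const_mul (hf : HeatSolution f) (hg : HeatSolution g) (a : ℝ) :
    HeatSolution (fun t u => f t u - a * g t u) where
  hasDeriv t u := ((hf.hasDeriv t u).sub ((hg.hasDeriv t u).const_mul a)).congr_deriv (by ring)
  bound T := by
    filter_upwards [hf.bound T, hg.bound T] with R ⟨C, hC⟩ ⟨C', hC'⟩
    refine ⟨C + |a| * C', fun t ht u => (abs_sub _ _).trans ?_⟩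
    rw [abs_mul, add_mul, mul_assoc]
    exact add_le_add (hC t ht u) (mul_le_mul_of_nonneg_left (hC' t ht u) (abs_nonneg a))

theorem dList {G : ℝ → ℤ → ℤ → ℝ} (hG : ∀ w, HeatSolution fun t u => G t u w) (l : List ℝ)
    (w : ℤ) : HeatSolution fun t u => DList l (G t u) w := by
  induction l generalizing w with
  | nil => exact hG w
  | cons a l ih => exact (ih w).sub_const_mul (ih (w - 1)) a

/-- The terms of the series `J` admit a locally uniform geometric bound. -/
theorem exists_geometric_bound (hf : HeatSolution f) {a : ℝ} (ha : 0 < a) (T : ℝ) :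
    ∀ᶠ R : ℝ in atTop, ∃ C, 0 < R ∧ (a * R)⁻¹ < 1 ∧ ∀ t, |t| ≤ T → ∀ (u : ℤ) (k : ℕ),
      |a ^ (-(k : ℤ)) * f t (u + k)| ≤ C * R ^ (-u) * (a * R)⁻¹ ^ k := by
  filter_upwards [hf.bound T, eventually_gt_atTop 0, eventually_gt_atTop a⁻¹] with R ⟨C, hC⟩ hR hR'
  refine ⟨C, hR, ?_, fun t ht u k => ?_⟩
  · refine inv_lt_one_of_one_lt₀ ?_
    rwa [mul_comm, ← inv_lt_iff_one_lt_mul₀ ha]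
  · rw [abs_mul, abs_of_nonneg (zpow_nonneg ha.le _)]
    refine (mul_le_mul_of_nonneg_left (hC t ht _) (zpow_nonneg ha.le _)).trans_eq ?_
    rw [neg_add, zpow_add₀ hR.ne', mul_inv, mul_pow, zpow_neg, zpow_neg R k, zpow_natCast,
      zpow_natCast, inv_pow, inv_pow]
    ring

theorem summable (hf : HeatSolution f) {a : ℝ} (ha : 0 < a) (t : ℝ) (u : ℤ) :
    Summable fun k : ℕ => a ^ (-(k : ℤ)) * f t (u + k) := by
  obtain ⟨R, C, hR, hR1, hC⟩ := (hf.exists_geometric_bound ha |t|).exists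
  refine Summable.of_norm_bounded
    ((summable_geometric_of_lt_one (by positivity) hR1).mul_left (C * R ^ (-u))) fun k => ?_
  exact hC t le_rfl u k

theorem J (hf : HeatSolution f) {a : ℝ} (ha : 0 < a) :
    HeatSolution (fun t u => PushASEP.J a (f t) u) where
  hasDeriv t u := by
    obtain ⟨R, C, hR, hR1, hC⟩ := (hf.exists_geometric_bound ha (|t| + 1)).exists
    have hgeo : ∀ u : ℤ, Summable fun k : ℕ => C * R ^ (-u) * (a * R)⁻¹ ^ k := fun u =>
      (summable_geometric_of_lt_one (by positivity) hR1).mul_left _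
    have habs : ∀ s ∈ Metric.ball t 1, |s| ≤ |t| + 1 := by
      intro s hs
      rw [Metric.mem_ball, Real.dist_eq] at hs
      linarith [abs_sub_abs_le_abs_sub s t]
    have e1 : ∀ k : ℕ, u + 1 + k = u + k + 1 := fun k => by ring
    have e2 : ∀ k : ℕ, u - 1 + k = u + k - 1 := fun k => by ring
    have hd := hasDerivAt_tsum_of_isPreconnected (y₀ := t) (y := t)
      (g := fun (k : ℕ) s => a ^ (-(k : ℤ)) * f s (u + k))
      (g' := fun (k : ℕ) s => a ^ (-(k : ℤ)) * f s (u + 1 + k) + a ^ (-(k : ℤ)) * f s (u - 1 + k))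
      ((hgeo (u + 1)).add (hgeo (u - 1))) Metric.isOpen_ball
      (convex_ball t 1).isPreconnected
      (fun k s _ => by
        rw [← mul_add, e1, e2]
        exact (hf.hasDeriv s (u + k)).const_mul _)
      (fun k s hs => (norm_add_le _ _).trans
        (add_le_add (hC s (habs s hs) _ k) (hC s (habs s hs) _ k)))
      (Metric.mem_ball_self one_pos) (hf.summable ha t u) (Metric.mem_ball_self one_pos)
    rwa [(hf.summable ha t _).tsum_add (hf.summable ha t _)] at hd
  bound T := by
    filter_upwards [hf.exists_geometric_bound ha T] with R ⟨C, hR, hR1, hC⟩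
    refine ⟨C * (1 - (a * R)⁻¹)⁻¹, fun t ht u => ?_⟩
    have h := tsum_of_norm_bounded (f := fun k : ℕ => a ^ (-(k : ℤ)) * f t (u + k))
      ((hasSum_geometric_of_lt_one (by positivity) hR1).mul_left (C * R ^ (-u)))
      (fun k => hC t ht u k)
    refine h.trans_eq ?_
    ring

theorem jList (hf : HeatSolution f) (l : List ℝ) (hl : ∀ a ∈ l, 0 < a) :
    HeatSolution (fun t u => JList l (f t) u) := by
  induction l with
  | nil => exact hf
  | cons a l ih =>
    exact (ih fun b hb => hl b (List.mem_cons_of_mem a hb)).J (hl a List.mem_cons_self)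

theorem J_eq (hf : HeatSolution f) {a : ℝ} (ha : 0 < a) (t : ℝ) (u : ℤ) :
    PushASEP.J a (f t) u = f t u + a⁻¹ * PushASEP.J a (f t) (u + 1) := by
  rw [PushASEP.J, (hf.summable ha t u).tsum_eq_zero_add, PushASEP.J, ← tsum_mul_left]
  simp only [Nat.cast_zero, neg_zero, zpow_zero, one_mul, add_zero]
  congr 2
  ext k
  rw [Nat.cast_succ, neg_add, zpow_add₀ ha.ne', zpow_neg_one, add_assoc u, add_comm 1 (k : ℤ)]
  ring

theorem jList_recursion (hf : HeatSolution f) (hh : HeatSolution h) {a : ℝ} (t : ℝ)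
    (hrec : ∀ u, h t u = f t u + a * h t (u + 1)) (l : List ℝ) (hl : ∀ b ∈ l, 0 < b) (u : ℤ) :
    JList l (h t) u = JList l (f t) u + a * JList l (h t) (u + 1) := by
  induction l generalizing u with
  | nil => exact hrec u
  | cons b l ih =>
    have hl' : ∀ b ∈ l, 0 < b := fun c hc => hl c (List.mem_cons_of_mem b hc)
    have hb : 0 < b := hl b List.mem_cons_self
    have hf' := hf.jList l hl'
    have hh' := hh.jList l hl'
    change PushASEP.J b (JList l (h t)) u = PushASEP.J b (JList l (f t)) u +
      a * PushASEP.J b (JList l (h t)) (u + 1)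
    rw [PushASEP.J, PushASEP.J, PushASEP.J, ← tsum_mul_left,
      ← (hf'.summable hb t u).tsum_add ((hh'.summable hb t (u + 1)).mul_left a)]
    congr 1
    ext k
    rw [ih hl', add_right_comm]
    ring

end HeatSolution

end HeatSolution

section PowerSeriesCoefficients

open PowerSeries

/-- The coefficient of `X ^ d` for an integer `d`. -/
def intCoeff (P : PowerSeries ℝ) (d : ℤ) : ℝ := if 0 ≤ d then coeff d.toNat P else 0

theorem intCoeff_of_neg (P : PowerSeries ℝ) {d : ℤ} (hd : d < 0) : intCoeff P d = 0 :=
  if_neg (not_le.2 hd)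

theorem intCoeff_one (d : ℤ) : intCoeff 1 d = if d = 0 then 1 else 0 := by
  rw [intCoeff]
  split_ifs with h1 h2 h2
  · simp [h2]
  · rw [coeff_one, if_neg (by omega)]
  · omega
  · rfl

/-- The linear factor `1 - X / a`. -/
def linFactor (a : ℝ) : PowerSeries ℝ := 1 - C a⁻¹ * X

theorem linFactor_mul_inv (a : ℝ) : linFactor a * (linFactor a)⁻¹ = 1 :=
  PowerSeries.mul_inv_cancel _ (by simp [linFactor])

theorem intCoeff_linFactor_mul (a : ℝ) (P : PowerSeries ℝ) (d : ℤ) :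
    intCoeff (linFactor a * P) d = intCoeff P d - a⁻¹ * intCoeff P (d - 1) := by
  rcases lt_or_ge d 0 with hd | hd
  · rw [intCoeff_of_neg _ hd, intCoeff_of_neg _ hd, intCoeff_of_neg _ (by omega)]
    simp
  · lift d to ℕ using hd
    rw [linFactor, sub_mul, one_mul, mul_assoc]
    cases d with
    | zero => simp [intCoeff]
    | succ d =>
      rw [intCoeff, intCoeff, intCoeff, if_pos (by omega), if_pos (by omega), if_pos (by omega)]
      have e1 : ((d + 1 : ℕ) : ℤ).toNat = d + 1 := by omega
      have e2 : (((d + 1 : ℕ) : ℤ) - 1).toNat = d := by omega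
      rw [e1, e2, map_sub, coeff_C_mul, coeff_succ_X_mul]

theorem DList_intCoeff (l : List ℝ) (P : PowerSeries ℝ) (u w : ℤ) :
    DList (l.map fun a => 1 / a) (fun w => intCoeff P (w - u)) w =
      intCoeff ((l.map linFactor).prod * P) (w - u) := by
  induction l generalizing w with
  | nil => simp [DList]
  | cons a l ih =>
    change D (1 / a) (DList (l.map fun a => 1 / a) fun w => intCoeff P (w - u)) w = _
    rw [D, ih, ih, List.map_cons, List.prod_cons, mul_assoc, intCoeff_linFactor_mul, one_div,
      sub_right_comm]

theorem J_intCoeff {a : ℝ} (ha : 0 < a) (P : PowerSeries ℝ) (u w : ℤ) :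
    J a (fun u => intCoeff P (w - u)) u = intCoeff ((linFactor a)⁻¹ * P) (w - u) := by
  obtain ⟨Q, hQ⟩ : ∃ Q, Q = (linFactor a)⁻¹ * P := ⟨_, rfl⟩
  have hP : P = linFactor a * Q := by rw [hQ, ← mul_assoc, linFactor_mul_inv, one_mul]
  rw [← hQ, hP, J]
  set N := (w - u + 1).toNat with hN
  rw [tsum_eq_sum (s := Finset.range N)]
  · have hterm : ∀ k : ℕ, a ^ (-(k : ℤ)) * intCoeff (linFactor a * Q) (w - (u + k)) =
        a ^ (-(k : ℤ)) * intCoeff Q (w - u - k) -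
          a ^ (-((k + 1 : ℕ) : ℤ)) * intCoeff Q (w - u - (k + 1 : ℕ)) := by
      intro k
      rw [intCoeff_linFactor_mul, Nat.cast_succ, neg_add, zpow_add₀ ha.ne', zpow_neg_one,
        show w - (u + k) = w - u - k by ring, show w - u - ((k : ℤ) + 1) = w - u - k - 1 by ring]
      ring
    simp only [hterm]
    rw [Finset.sum_range_sub', intCoeff_of_neg Q (d := w - u - N) (by omega)]
    simp
  · intro k hk
    rw [Finset.mem_range, not_lt] at hk
    rw [intCoeff_of_neg _ (by omega), mul_zero]

theorem JList_intCoeff (l : List ℝ) (hl : ∀ a ∈ l, 0 < a) (P : PowerSeries ℝ) (u w : ℤ) :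
    JList l (fun u => intCoeff P (w - u)) u =
      intCoeff ((l.map fun a => (linFactor a)⁻¹).prod * P) (w - u) := by
  induction l generalizing u with
  | nil => simp [JList]
  | cons a l ih =>
    change J a (JList l fun u => intCoeff P (w - u)) u = _
    have h := funext fun u => ih (fun b hb => hl b (List.mem_cons_of_mem a hb)) u
    rw [h, J_intCoeff (hl a List.mem_cons_self), List.map_cons, List.prod_cons, mul_assoc]

theorem JList_congr (l : List ℝ) {f g : ℤ → ℝ} {u₀ : ℤ} (h : ∀ u, u₀ ≤ u → f u = g u) {u : ℤ}
    (hu : u₀ ≤ u) : JList l f u = JList l g u := by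
  induction l generalizing u with
  | nil => exact h u hu
  | cons a l ih => exact tsum_congr fun k => congrArg _ (ih (by omega))

theorem DList_congr (l : List ℝ) {f g : ℤ → ℝ} {w₀ : ℤ} (h : ∀ w, w₀ ≤ w → f w = g w) {w : ℤ}
    (hw : w₀ + l.length ≤ w) : DList l f w = DList l g w := by
  induction l generalizing w with
  | nil => exact h w (by simpa using hw)
  | cons a l ih =>
    rw [List.length_cons, Nat.cast_succ] at hw
    exact congrArg₂ (fun x y => x - a * y) (ih (by omega)) (ih (by omega))

theorem coeff_prod_linFactor (l : List ℝ) {d : ℕ} (hd : l.length < d) :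
    coeff d (l.map linFactor).prod = 0 := by
  induction l generalizing d with
  | nil =>
    rw [List.map_nil, List.prod_nil, coeff_one, if_neg]
    exact (Nat.pos_of_ne_zero (by rintro rfl; simp at hd)).ne'
  | cons a l ih =>
    rw [List.length_cons] at hd
    obtain ⟨d, rfl⟩ : ∃ e, d = e + 1 := ⟨d - 1, by omega⟩
    rw [List.map_cons, List.prod_cons, linFactor, sub_mul, one_mul, mul_assoc, map_sub,
      coeff_C_mul, coeff_succ_X_mul, ih (by omega), ih (by omega)]
    simp

end PowerSeriesCoefficients

section Entries

variable {n : ℕ}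

theorem DList_add_const_mul (l : List ℝ) (f g : ℤ → ℝ) (a : ℝ) (w : ℤ) :
    DList l (fun w => f w + a * g w) w = DList l f w + a * DList l g w := by
  induction l generalizing w with
  | nil => rfl
  | cons b l ih =>
    change DList l (fun w => f w + a * g w) w - b * DList l (fun w => f w + a * g w) (w - 1) =
      (DList l f w - b * DList l f (w - 1)) + a * (DList l g w - b * DList l g (w - 1))
    rw [ih, ih]
    ring

theorem prefixList_pos {v : Fin n → ℝ} (hv : ∀ i, 0 < v i) (i : Fin n) :
    ∀ a ∈ prefixList v i, 0 < a := by
  intro a ha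
  obtain ⟨k, rfl⟩ := (List.mem_ofFn' v a).1 (List.mem_of_mem_take ha)
  exact hv k

theorem length_prefixList (v : Fin n → ℝ) (i : Fin n) : (prefixList v i).length = i + 1 := by
  simp [prefixList]

theorem prefixList_eq_take (v : Fin n → ℝ) {i j : Fin n} (hij : i ≤ j) :
    prefixList v i = (prefixList v j).take (i + 1) := by
  have : (i : ℕ) ≤ j := hij
  rw [prefixList, prefixList, List.take_take, min_eq_left (by omega)]

theorem prefixList_of_val_eq_zero (v : Fin n → ℝ) {i : Fin n} (hi : (i : ℕ) = 0) :
    prefixList v i = [v i] := by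
  have hn : 0 < (List.ofFn v).length := by simpa using i.pos
  rw [prefixList, hi, ← List.take_concat_get' _ 0 hn]
  simp [← hi]

theorem prefixList_succ (v : Fin n → ℝ) {i k : Fin n} (hk : (k : ℕ) = i + 1) :
    prefixList v k = prefixList v i ++ [v k] := by
  have hn : (k : ℕ) < (List.ofFn v).length := by simp
  rw [prefixList, ← List.take_concat_get' _ _ hn, prefixList, ← hk]
  simp

theorem heatSolution_F {v : Fin n → ℝ} (hv : ∀ i, 0 < v i) (i j : Fin n) (w : ℤ) :
    HeatSolution (fun t u => F v i j t u w) :=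
  HeatSolution.dList (G := fun t u w => JList (prefixList v i) (fun u => psi t u w) u)
    (fun w => (heatSolution_psi w).jList _ (prefixList_pos hv i)) _ w

theorem F_succ {v : Fin n → ℝ} (hv : ∀ i, 0 < v i) {i k : Fin n} (hk : (k : ℕ) = i + 1)
    (j : Fin n) (t : ℝ) (u w : ℤ) :
    F v k j t u w = F v i j t u w + (v k)⁻¹ * F v k j t (u + 1) w := by
  rw [F, F, F, ← DList_add_const_mul]
  congr 1
  ext w
  have h : ∀ f, JList (prefixList v k) f = JList (prefixList v i) (J (v k) f) := fun f => by
    rw [prefixList_succ v hk, JList, List.foldr_append]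
    rfl
  rw [h]
  exact (heatSolution_psi w).jList_recursion ((heatSolution_psi w).J (hv k)) t
    ((heatSolution_psi w).J_eq (hv k) t) _ (prefixList_pos hv i) u

theorem F_neg_one {v : Fin n → ℝ} (hv : ∀ i, 0 < v i) {i : Fin n} (hi : (i : ℕ) = 0)
    (j : Fin n) (t : ℝ) (w : ℤ) : F v i j t (-1) w = (v i)⁻¹ * F v i j t 0 w := by
  have h := DList_add_const_mul ((prefixList v j).map fun a => 1 / a) (fun _ => 0)
    (fun w => JList (prefixList v i) (fun u => psi t u w) 0) (v i)⁻¹ w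
  have h0 := DList_add_const_mul ((prefixList v j).map fun a => 1 / a) (fun _ => 0)
    (fun _ => 0) (-1) w
  simp only [mul_zero, add_zero, neg_mul, one_mul, add_neg_cancel] at h0
  rw [h0, zero_add] at h
  rw [F, F, ← h]
  congr 1
  ext w
  rw [prefixList_of_val_eq_zero v hi, zero_add]
  have := (heatSolution_psi w).J_eq (hv i) t (-1)
  rwa [psi_neg_one, zero_add, neg_add_cancel] at this

theorem F_zero {v : Fin n → ℝ} (hv : ∀ i, 0 < v i) (i j : Fin n) {u w : ℤ} (hu : 0 ≤ u)
    (hw : (j : ℕ) ≤ w) :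
    F v i j 0 u w = intCoeff (((prefixList v j).map linFactor).prod *
      ((prefixList v i).map fun a => (linFactor a)⁻¹).prod) (w - u) := by
  rw [← DList_intCoeff, F]
  refine DList_congr (w₀ := -1) _ (fun w hw => ?_) ?_
  · rw [← mul_one (List.prod _), ← JList_intCoeff _ (prefixList_pos hv i)]
    exact JList_congr (u₀ := 0) _ (fun u hu => by rw [psi_zero hu hw, intCoeff_one]) hu
  · rw [List.length_map, length_prefixList]
    push_cast
    omega

theorem prod_linFactor_mul_inv (l : List ℝ) :
    (l.map linFactor).prod * (l.map fun a => (linFactor a)⁻¹).prod = 1 := by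
  rw [← List.prod_map_mul]
  simp [linFactor_mul_inv]

theorem F_zero_self {v : Fin n → ℝ} (hv : ∀ i, 0 < v i) (i : Fin n) {u w : ℤ} (hu : 0 ≤ u)
    (hw : (i : ℕ) ≤ w) : F v i i 0 u w = if w - u = 0 then 1 else 0 := by
  rw [F_zero hv i i hu hw, prod_linFactor_mul_inv, intCoeff_one]

theorem F_zero_of_lt {v : Fin n → ℝ} (hv : ∀ i, 0 < v i) (i j : Fin n) {u w : ℤ} (hu : 0 ≤ u)
    (hw : (j : ℕ) ≤ w) (h : w < u) : F v i j 0 u w = 0 := by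
  rw [F_zero hv i j hu hw, intCoeff_of_neg _ (by omega)]

theorem F_zero_of_gt {v : Fin n → ℝ} (hv : ∀ i, 0 < v i) {i j : Fin n} (hij : i ≤ j) {u w : ℤ}
    (hu : 0 ≤ u) (hw : (j : ℕ) ≤ w) (h : u + j < w + i) : F v i j 0 u w = 0 := by
  have hij' : (i : ℕ) ≤ j := hij
  have e : ((prefixList v j).map linFactor).prod *
      ((prefixList v i).map fun a => (linFactor a)⁻¹).prod =
      (((prefixList v j).drop (i + 1)).map linFactor).prod := by
    conv_lhs => rw [← List.take_append_drop (i + 1) (prefixList v j), ← prefixList_eq_take v hij]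
    rw [List.map_append, List.prod_append, mul_right_comm, prod_linFactor_mul_inv, one_mul]
  rw [F_zero hv i j hu hw, e, intCoeff]
  split_ifs with hd
  · refine coeff_prod_linFactor _ ?_
    rw [List.length_drop, length_prefixList]
    omega
  · rfl

end Entries

section Kernel

variable {n : ℕ}

/-- The matrix whose determinant enters the definition of `r`. -/
def kernelMatrix (v : Fin n → ℝ) (t : ℝ) (x y : Fin n → ℤ) : Matrix (Fin n) (Fin n) ℝ :=
  Matrix.of fun i j => F v i j t (x i + (i : ℕ)) (y j + (j : ℕ))

/-- The factor in front of the determinant in the definition of `r`. -/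
def prefactor (v : Fin n → ℝ) (t : ℝ) (x y : Fin n → ℤ) : ℝ :=
  ∏ k, v k ^ (y k - x k) * Real.exp (-t * (v k + 1 / v k))

theorem r_add_single {v : Fin n → ℝ} (hv : ∀ i, 0 < v i) (t : ℝ) (x y : Fin n → ℤ) (k : Fin n)
    (a : ℤ) : r v t (x + Pi.single k a) y = prefactor v t x y * (v k ^ (-a) *
      ((kernelMatrix v t x y).updateRow k
        (fun j => F v k j t (x k + (k : ℕ) + a) (y j + (j : ℕ)))).det) := by
  have h1 : prefactor v t (x + Pi.single k a) y = prefactor v t x y * v k ^ (-a) := by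
    have : ∀ i, v i ^ (y i - (x + Pi.single k a : Fin n → ℤ) i) * Real.exp (-t * (v i + 1 / v i)) =
        v i ^ (y i - x i) * Real.exp (-t * (v i + 1 / v i)) * if i = k then v k ^ (-a) else 1 := by
      intro i
      rcases eq_or_ne i k with rfl | hi
      · rw [if_pos rfl, Pi.add_apply, Pi.single_eq_same, sub_add_eq_sub_sub, sub_eq_add_neg _ a,
          zpow_add₀ (hv i).ne']
        ring
      · simp [hi]
    simp only [prefactor, this, Finset.prod_mul_distrib, Finset.prod_ite_eq', Finset.mem_univ,
      if_true]
  have h2 : kernelMatrix v t (x + Pi.single k a) y = (kernelMatrix v t x y).updateRow k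
      (fun j => F v k j t (x k + (k : ℕ) + a) (y j + (j : ℕ))) := by
    ext i j
    rcases eq_or_ne i k with rfl | hi
    · simp [kernelMatrix, add_right_comm]
    · simp [kernelMatrix, hi]
  rw [← mul_assoc, ← h1, ← h2]
  rfl

theorem r_eq_of_collision {v : Fin n → ℝ} (hv : ∀ i, 0 < v i) (t : ℝ) (x y : Fin n → ℤ)
    {i k : Fin n} (hk : (k : ℕ) = i + 1) (hx : x k = x i - 1) :
    r v t (x + Pi.single k 1) y = r v t x y := by
  have h0 := r_add_single hv t x y k 0
  rw [Pi.single_zero, add_zero, neg_zero, zpow_zero, one_mul] at h0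
  rw [h0, r_add_single hv t x y k 1, zpow_neg_one]
  congr 1
  have hrow : (fun j : Fin n => F v k j t (x k + (k : ℕ) + 0) (y j + (j : ℕ))) =
      kernelMatrix v t x y i +
        (v k)⁻¹ • (fun j => F v k j t (x k + (k : ℕ) + 1) (y j + (j : ℕ))) := by
    ext j
    have hu : x k + (k : ℕ) = x i + (i : ℕ) := by rw [hx, hk]; push_cast; ring
    rw [add_zero, F_succ hv hk, hu]
    rfl
  have hne : i ≠ k := by
    rintro rfl
    omega
  rw [hrow, Matrix.det_updateRow_add, Matrix.det_updateRow_smul, Matrix.det_updateRow_eq_zero hne,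
    zero_add]

theorem r_eq_of_wall {v : Fin n → ℝ} (hv : ∀ i, 0 < v i) (t : ℝ) (x y : Fin n → ℤ)
    {k : Fin n} (hk : (k : ℕ) = 0) (hx : x k = -1) :
    r v t (x + Pi.single k 1) y = r v t x y := by
  have h0 := r_add_single hv t x y k 0
  rw [Pi.single_zero, add_zero, neg_zero, zpow_zero, one_mul] at h0
  rw [h0, r_add_single hv t x y k 1, zpow_neg_one, ← Matrix.det_updateRow_smul]
  congr 3
  ext j
  rw [hx, hk]
  exact (F_neg_one hv hk j t _).symm

theorem hasDerivAt_det {M : ℝ → Matrix (Fin n) (Fin n) ℝ} {M' : Matrix (Fin n) (Fin n) ℝ} {t : ℝ}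
    (h : ∀ i j, HasDerivAt (fun t => M t i j) (M' i j) t) :
    HasDerivAt (fun t => (M t).det) (∑ i, ((M t).updateRow i (M' i)).det) t := by
  let f : ContinuousMultilinearMap ℝ (fun _ : Fin n => Fin n → ℝ) ℝ :=
    { (Matrix.detRowAlternating (n := Fin n) (R := ℝ)).toMultilinearMap with
      cont := Continuous.matrix_det continuous_id }
  have hrow : ∀ i, HasDerivAt (fun t => M t i) (M' i) t := fun i => hasDerivAt_pi.2 (h i)
  have hd := (HasFDerivAt.multilinear_comp (f := f) fun i => (hrow i).hasFDerivAt).hasDerivAt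
  refine hd.congr_deriv ?_
  rw [sum_apply]
  refine Finset.sum_congr rfl fun i _ => ?_
  simp [f, Matrix.updateRow]
  rfl

theorem hasDerivAt_r {v : Fin n → ℝ} (hv : ∀ i, 0 < v i) (t : ℝ) (x y : Fin n → ℤ) :
    HasDerivAt (fun t => r v t x y)
      (∑ k, (v k * (r v t (x + Pi.single k 1) y - r v t x y) +
        (v k)⁻¹ * (r v t (x - Pi.single k 1) y - r v t x y))) t := by
  have hpre : HasDerivAt (fun t => prefactor v t x y)
      (-(∑ k, (v k + 1 / v k)) * prefactor v t x y) t := by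
    have e : ∀ t, prefactor v t x y =
        (∏ k, v k ^ (y k - x k)) * Real.exp (-(∑ k, (v k + 1 / v k)) * t) := by
      intro t
      rw [prefactor, Finset.prod_mul_distrib, ← Real.exp_sum, ← Finset.mul_sum]
      ring_nf
    simp only [e]
    have h1 : HasDerivAt (fun t => -(∑ k, (v k + 1 / v k)) * t) (-(∑ k, (v k + 1 / v k))) t := by
      simpa using (hasDerivAt_id t).const_mul (-(∑ k, (v k + 1 / v k)))
    refine (h1.exp.const_mul _).congr_deriv ?_
    ring
  have hdet := hasDerivAt_det (M := fun t => kernelMatrix v t x y)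
    (M' := Matrix.of fun i j => F v i j t (x i + (i : ℕ) + 1) (y j + (j : ℕ)) +
      F v i j t (x i + (i : ℕ) - 1) (y j + (j : ℕ)))
    (fun i j => (heatSolution_F hv i j _).hasDeriv t (x i + (i : ℕ)))
  refine (hpre.mul hdet).congr_deriv ?_
  have hplus : ∀ k, v k * r v t (x + Pi.single k 1) y = prefactor v t x y *
      ((kernelMatrix v t x y).updateRow k
        (fun j => F v k j t (x k + (k : ℕ) + 1) (y j + (j : ℕ)))).det := by
    intro k
    rw [r_add_single hv, zpow_neg_one]
    have := (hv k).ne'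
    field_simp
  have hminus : ∀ k, (v k)⁻¹ * r v t (x - Pi.single k 1) y = prefactor v t x y *
      ((kernelMatrix v t x y).updateRow k
        (fun j => F v k j t (x k + (k : ℕ) - 1) (y j + (j : ℕ)))).det := by
    intro k
    rw [sub_eq_add_neg, ← Pi.single_neg, r_add_single hv, neg_neg, zpow_one]
    have := (hv k).ne'
    field_simp
    rfl
  simp only [mul_sub, hplus, hminus]
  rw [neg_mul, neg_mul, Finset.sum_mul, Finset.sum_mul, ← Finset.sum_neg_distrib, Finset.mul_sum,
    ← Finset.sum_add_distrib]
  refine Finset.sum_congr rfl fun k _ => ?_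
  have e : (Matrix.of fun i j => F v i j t (x i + (i : ℕ) + 1) (y j + (j : ℕ)) +
      F v i j t (x i + (i : ℕ) - 1) (y j + (j : ℕ))) k =
      (fun j => F v k j t (x k + (k : ℕ) + 1) (y j + (j : ℕ))) +
        (fun j => F v k j t (x k + (k : ℕ) - 1) (y j + (j : ℕ))) := rfl
  rw [e, Matrix.det_updateRow_add, show r v t x y = prefactor v t x y * (kernelMatrix v t x y).det
    from rfl, one_div]
  ring

theorem r_bounded {v : Fin n → ℝ} (hv : ∀ i, 0 < v i) (y : Fin n → ℤ) (T : ℝ) :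
    ∃ C, ∀ t ∈ Set.Icc 0 T, ∀ x : Fin n → ℤ, (∀ i, 0 ≤ x i) → |r v t x y| ≤ C := by
  have hev : ∀ᶠ R : ℝ in atTop, ∀ i j : Fin n, ∃ C, ∀ t, |t| ≤ T → ∀ u : ℤ,
      |F v i j t u (y j + (j : ℕ))| ≤ C * R ^ (-u) :=
    eventually_all.2 fun i => eventually_all.2 fun j => (heatSolution_F hv i j _).bound T
  obtain ⟨R, hR, hRv, hR1⟩ := (hev.and ((eventually_all.2 fun k : Fin n =>
    eventually_ge_atTop (v k)⁻¹).and (eventually_ge_atTop 1))).exists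
  have hR0 : 0 < R := by linarith
  choose C hC using hR
  set B : ℝ := ∑ i, ∑ j, v i ^ y i * |C i j| with hB
  refine ⟨n.factorial * B ^ n, fun t ht x hx => ?_⟩
  have ht' : |t| ≤ T := by rw [abs_of_nonneg ht.1]; exact ht.2
  rw [r, ← Matrix.det_mul_column]
  have h := Matrix.det_le (abv := AbsoluteValue.abs) (x := B)
    (A := Matrix.of fun i j => v i ^ (y i - x i) * Real.exp (-t * (v i + 1 / v i)) *
      F v i j t (x i + (i : ℕ)) (y j + (j : ℕ))) fun i j => ?_
  · simpa [nsmul_eq_mul] using h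
  · have h1 : v i ^ y i * |C i j| ≤ B := by
      have h0 : ∀ i j, 0 ≤ v i ^ y i * |C i j| := fun i j =>
        mul_nonneg (zpow_nonneg (hv i).le _) (abs_nonneg _)
      exact (Finset.single_le_sum (fun j _ => h0 i j) (Finset.mem_univ j)).trans
        (Finset.single_le_sum (f := fun i => ∑ j, v i ^ y i * |C i j|)
          (fun i _ => Finset.sum_nonneg fun j _ => h0 i j) (Finset.mem_univ i))
    refine le_trans ?_ h1
    change |v i ^ (y i - x i) * Real.exp (-t * (v i + 1 / v i)) *
      F v i j t (x i + (i : ℕ)) (y j + (j : ℕ))| ≤ _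
    have hvi := hv i
    have hexp : Real.exp (-t * (v i + 1 / v i)) ≤ 1 := by
      rw [Real.exp_le_one_iff, neg_mul, neg_nonpos]
      exact mul_nonneg ht.1 (by positivity)
    have hpow : (v i) ^ (-x i) * R ^ (-(x i + (i : ℕ))) ≤ 1 := by
      have hvR : 1 ≤ v i * R := by rw [← inv_le_iff_one_le_mul₀' hvi]; exact hRv i
      rw [neg_add, zpow_add₀ hR0.ne', ← mul_assoc, ← mul_zpow]
      exact mul_le_one₀ (zpow_le_one_of_nonpos₀ hvR (by have := hx i; omega))
        (zpow_nonneg hR0.le _) (zpow_le_one_of_nonpos₀ hR1 (by omega))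
    rw [abs_mul, abs_of_nonneg (by positivity), sub_eq_add_neg, zpow_add₀ hvi.ne']
    calc _ ≤ v i ^ y i * v i ^ (-x i) * 1 * (|C i j| * R ^ (-(x i + (i : ℕ)))) := by
          gcongr
          exact (hC i j t ht' _).trans (by gcongr; exact le_abs_self _)
      _ = v i ^ y i * |C i j| * (v i ^ (-x i) * R ^ (-(x i + (i : ℕ)))) := by ring
      _ ≤ v i ^ y i * |C i j| * 1 := by gcongr
      _ = _ := mul_one _

theorem r_zero {v : Fin n → ℝ} (hv : ∀ i, 0 < v i) {x y : Fin n → ℤ} (hx0 : ∀ i, 0 ≤ x i)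
    (hx : Monotone x) (hy0 : ∀ i, 0 ≤ y i) (hy : Monotone y) :
    r v 0 x y = if x = y then 1 else 0 := by
  have hu : ∀ i : Fin n, 0 ≤ x i + (i : ℕ) := fun i => by have := hx0 i; omega
  have hw : ∀ j : Fin n, ((j : ℕ) : ℤ) ≤ y j + (j : ℕ) := fun j => by have := hy0 j; omega
  have hdiag : ∀ i, F v i i 0 (x i + (i : ℕ)) (y i + (i : ℕ)) = if x i = y i then 1 else 0 := by
    intro i
    rw [F_zero_self hv i (hu i) (hw i)]
    by_cases h : x i = y i
    · simp [h]
    · rw [if_neg h, if_neg (by omega)]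
  have hdet : (kernelMatrix v 0 x y).det = ∏ i, if x i = y i then (1 : ℝ) else 0 := by
    rw [Matrix.det_apply, Finset.sum_eq_single 1]
    · simp [kernelMatrix, hdiag]
    · intro σ _ hσ
      suffices ∃ i, kernelMatrix v 0 x y (σ i) i = 0 by
        obtain ⟨i, hi⟩ := this
        exact smul_eq_zero_of_right _ (Finset.prod_eq_zero (Finset.mem_univ i) hi)
      by_contra! hne
      have hsupp : σ.support.Nonempty := by
        rw [Finset.nonempty_iff_ne_empty]
        exact fun h => hσ (Equiv.Perm.support_eq_empty_iff.1 h)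
      set k := σ.support.min' hsupp with hk
      have hkm : k ∈ σ.support := Finset.min'_mem _ _
      have hmin : ∀ i ∈ σ.support, k ≤ i := fun i hi => Finset.min'_le _ _ hi
      have h1 : k < σ k :=
        lt_of_le_of_ne (hmin _ (Equiv.Perm.apply_mem_support.2 hkm))
          (Ne.symm (Equiv.Perm.mem_support.1 hkm))
      obtain ⟨l, hl⟩ := σ.surjective k
      have h2 : k < l := by
        have hlk : l ≠ k := by
          intro h
          rw [h] at hl
          exact h1.ne' hl
        refine lt_of_le_of_ne (hmin _ (Equiv.Perm.mem_support.2 ?_)) hlk.symm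
        rw [hl]
        exact hlk.symm
      have hn1 : ¬y k + (k : ℕ) < x (σ k) + (σ k : ℕ) := fun h =>
        hne k (F_zero_of_lt hv _ _ (hu _) (hw _) h)
      have hn2 : ¬x k + (k : ℕ) + (l : ℕ) < y l + (l : ℕ) + (k : ℕ) := fun h => by
        refine hne l ?_
        rw [hl]
        exact F_zero_of_gt hv h2.le (hu _) (hw _) h
      have h3 := hx h1.le
      have h4 := hy h2.le
      have h1' : (k : ℕ) < σ k := h1
      omega
    · simp
  rw [r, show (Matrix.of fun i j : Fin n => F v i j 0 (x i + (i : ℕ)) (y j + (j : ℕ))).det = _ from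
    hdet]
  split_ifs with h
  · subst h
    simp
  · obtain ⟨i, hi⟩ := Function.ne_iff.1 h
    rw [Finset.prod_eq_zero (Finset.mem_univ i) (f := fun i => if x i = y i then (1 : ℝ) else 0)
      (if_neg hi), mul_zero]

end Kernel

section Moves

variable {n : ℕ}

/-- The configuration in which the particle `k` has jumped to the right and has pushed the
particles at its site with a larger index. -/
def pushRight (x : State n) (k : Fin n) : State n :=
  ⟨fun l => x.1 l + if k ≤ l ∧ x.1 l = x.1 k then 1 else 0, by
    obtain ⟨x, h0, hx⟩ := x
    refine ⟨fun l => ?_, fun l l' hl => ?_⟩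
    · have := h0 l
      dsimp only
      split_ifs <;> omega
    · have h := hx hl
      dsimp only
      split_ifs with h1 h2 h2
      · omega
      · have : x l ≠ x l' := fun h3 => h2 ⟨h1.1.trans hl, h3 ▸ h1.2⟩
        omega
      · omega
      · omega⟩

/-- The particle `k` can jump to the left. -/
def CanJumpLeft (x : State n) (k : Fin n) : Prop :=
  (∀ i, 0 ≤ (x.1 - Pi.single k 1 : Fin n → ℤ) i) ∧ Monotone (x.1 - Pi.single k 1 : Fin n → ℤ)

open Classical in
/-- The configuration in which the particle `k` has jumped to the left, if this is possible. -/
def jumpLeft (x : State n) (k : Fin n) : State n :=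
  if h : CanJumpLeft x k then ⟨x.1 - Pi.single k 1, h⟩ else x

theorem jumpLeft_of_can {x : State n} {k : Fin n} (h : CanJumpLeft x k) :
    (jumpLeft x k).1 = x.1 - Pi.single k 1 :=
  congrArg Subtype.val (dif_pos h : jumpLeft x k = ⟨x.1 - Pi.single k 1, h⟩)

theorem jumpLeft_of_not_can {x : State n} {k : Fin n} (h : ¬CanJumpLeft x k) : jumpLeft x k = x :=
  dif_neg h

/-- The moves of PushASEP with a wall. -/
def move (i : Fin n ⊕ Fin n) (x : State n) : State n :=
  i.elim (pushRight x) (jumpLeft x)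

/-- The rates of the moves. -/
def moveRate (v : Fin n → ℝ) (i : Fin n ⊕ Fin n) : ℝ := i.elim v fun k => (v k)⁻¹

theorem block_of_top (x : State n) {k j : Fin n} (hx : ∀ l, k ≤ l → l ≤ j → x.1 l = x.1 k)
    (hkj : k ≤ j) (hj : ∀ l : Fin n, (l : ℕ) = (j : ℕ) + 1 → x.1 j < x.1 l) :
    x.1 + block k j = (pushRight x k).1 := by
  ext l
  simp only [Pi.add_apply, block, pushRight]
  congr 1
  refine if_congr ⟨fun h => ⟨h.1, hx l h.1 h.2⟩, fun h => ⟨h.1, ?_⟩⟩ rfl rfl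
  by_contra hlj
  have hlj : (j : ℕ) < l := not_le.1 hlj
  have h1 := hj ⟨j + 1, by omega⟩ rfl
  have h2 : x.1 ⟨j + 1, by omega⟩ ≤ x.1 l := x.2.2 (Fin.mk_le_of_le_val (by omega))
  have h3 := hx j hkj le_rfl
  omega

theorem exists_top (x : State n) (k : Fin n) : ∃ j, k ≤ j ∧
    (∀ l, k ≤ l → l ≤ j → x.1 l = x.1 k) ∧
    ∀ l : Fin n, (l : ℕ) = (j : ℕ) + 1 → x.1 j < x.1 l := by
  classical
  set s := Finset.univ.filter fun l => k ≤ l ∧ x.1 l = x.1 k with hs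
  have hne : s.Nonempty := ⟨k, by simp [hs]⟩
  have hmem : s.max' hne ∈ s := Finset.max'_mem _ _
  set j := s.max' hne with hj
  obtain ⟨-, hkj, hxj⟩ := Finset.mem_filter.1 hmem
  refine ⟨j, hkj, fun l hkl hlj => le_antisymm (hxj ▸ x.2.2 hlj) (x.2.2 hkl), fun l hl => ?_⟩
  have hjl : j < l := Fin.lt_def.2 (by omega)
  refine lt_of_le_of_ne (x.2.2 hjl.le) fun h => ?_
  have : l ∈ s := Finset.mem_filter.2 ⟨Finset.mem_univ _, hkj.trans hjl.le, by rw [← h, hxj]⟩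
  exact absurd (Finset.le_max' s l this) (not_le.2 hjl)

theorem block_injective {k j j' : Fin n} (hj : k ≤ j) (hj' : k ≤ j') (h : block k j = block k j') :
    j = j' := by
  have h1 := congrFun h j
  have h2 := congrFun h j'
  simp only [block, hj, hj', le_rfl, and_self, true_and, if_true] at h1 h2
  refine le_antisymm ?_ ?_
  · by_contra hc
    simp [hc] at h1
  · by_contra hc
    simp [hc] at h2

open Classical in
theorem rate_eq (v : Fin n → ℝ) {x z : State n} (hxz : x ≠ z) :
    rate v x z = ∑ i, moveRate v i * if move i x = z then 1 else 0 := by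
  rw [rate, Fintype.sum_sum_type]
  congr 1
  · refine Finset.sum_congr rfl fun k _ => ?_
    obtain ⟨j, hkj, hx, hj⟩ := exists_top x k
    have hb := block_of_top x hx hkj hj
    rw [Finset.sum_eq_single j]
    · rw [hb]
      refine Eq.trans (if_congr ⟨fun h => ?_, fun h => ?_⟩ rfl rfl) (mul_boole _ _).symm
      · exact Subtype.ext h.2.1.symm
      · exact ⟨hkj, congrArg Subtype.val h.symm, hx, hj⟩
    · intro j' _ hne
      refine if_neg fun h => hne ?_
      have hb' := block_of_top x h.2.2.1 h.1 h.2.2.2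
      exact block_injective h.1 hkj (add_left_cancel (hb'.trans hb.symm))
    · exact fun h => absurd (Finset.mem_univ j) h
  · refine Finset.sum_congr rfl fun k _ => ?_
    refine Eq.trans (if_congr ⟨fun h => ?_, fun h => ?_⟩ rfl rfl) (mul_boole _ _).symm
    · have hz : CanJumpLeft x k := by
        rw [CanJumpLeft, ← h]
        exact z.2
      exact Subtype.ext ((jumpLeft_of_can hz).trans h.symm)
    · have h : jumpLeft x k = z := h
      by_cases hz : CanJumpLeft x k
      · rw [← h, jumpLeft_of_can hz]
      · exact absurd ((jumpLeft_of_not_can hz).symm.trans h) hxz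

theorem moveRate_nonneg {v : Fin n → ℝ} (hv : ∀ i, 0 < v i) (i : Fin n ⊕ Fin n) :
    0 ≤ moveRate v i := by
  cases i with
  | inl k => exact (hv k).le
  | inr k => exact (inv_pos.2 (hv k)).le

theorem qMatrix_rate [TopologicalSpace (State n)] [DiscreteTopology (State n)] (v : Fin n → ℝ)
    (x z : State n) : qMatrix (rate v) x z = gen (moveRate v) move (dirac z) x := by
  classical
  rw [qMatrix, gen]
  split_ifs with h
  · subst h
    have hsum : HasSum (fun z => if z = x then 0 else rate v x z)
        (∑ i, moveRate v i * (1 - if move i x = x then 1 else 0)) := by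
      have : ∀ z, (if z = x then 0 else rate v x z) =
          ∑ i, if z = x then 0 else moveRate v i * if move i x = z then 1 else 0 := by
        intro z
        split_ifs with hz
        · simp
        · exact rate_eq v (Ne.symm hz)
      simp only [this]
      refine hasSum_sum fun i _ => ?_
      have h1 := hasSum_single (f := fun z => if z = x then 0 else
        moveRate v i * if move i x = z then 1 else 0) (move i x)
        (fun z hz => by simp [Ne.symm hz])
      convert h1 using 1
      by_cases h2 : move i x = x <;> simp [h2]
    rw [hsum.tsum_eq, ← Finset.sum_neg_distrib]
    refine Finset.sum_congr rfl fun i _ => ?_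
    simp [dirac_apply, ← mul_neg]
  · rw [rate_eq v h]
    refine Finset.sum_congr rfl fun i _ => ?_
    simp [dirac_apply, h]

theorem r_jumpLeft {v : Fin n → ℝ} (hv : ∀ i, 0 < v i) (t : ℝ) (x : State n) (y : Fin n → ℤ)
    (k : Fin n) : r v t (jumpLeft x k).1 y = r v t (x.1 - Pi.single k 1) y := by
  by_cases h : CanJumpLeft x k
  · rw [jumpLeft_of_can h]
  rw [jumpLeft_of_not_can h]
  have e : x.1 = x.1 - Pi.single k 1 + Pi.single k 1 := (sub_add_cancel _ _).symm
  rcases Nat.eq_zero_or_pos (k : ℕ) with hk | hk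
  · suffices hx : x.1 k = 0 by
      conv_lhs => rw [e]
      exact r_eq_of_wall hv t _ y hk (by simp [hx])
    by_contra hx
    have hpos : 0 < x.1 k := lt_of_le_of_ne (x.2.1 k) (Ne.symm hx)
    refine h ⟨fun i => ?_, fun i j hij => ?_⟩
    · have := x.2.1 i
      rcases eq_or_ne i k with rfl | hi
      · simp only [Pi.sub_apply, Pi.single_eq_same]
        omega
      · simpa [hi] using this
    · have := x.2.2 hij
      have hki : k ≤ i := Fin.le_def.2 (by omega)
      rcases eq_or_ne i k with rfl | hi
      · rcases eq_or_ne j i with rfl | hj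
        · rfl
        · simp only [Pi.sub_apply, Pi.single_eq_same, Pi.single_eq_of_ne hj]
          omega
      · have hj : j ≠ k := fun hj => hi (le_antisymm (hj ▸ hij) hki)
        simpa [hi, hj] using this
  · obtain ⟨i, hi⟩ : ∃ i : Fin n, (k : ℕ) = i + 1 := ⟨⟨k - 1, by omega⟩, by simp; omega⟩
    have hik : i < k := Fin.lt_def.2 (by omega)
    suffices hx : x.1 k = x.1 i by
      conv_lhs => rw [e]
      exact r_eq_of_collision hv t _ y hi (by simp [hx, hik.ne])
    by_contra hx
    have hlt : x.1 i < x.1 k := lt_of_le_of_ne (x.2.2 hik.le) (Ne.symm hx)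
    have h0 := x.2.1 i
    refine h ⟨fun l => ?_, fun l m hlm => ?_⟩
    · have := x.2.1 l
      rcases eq_or_ne l k with rfl | hl
      · simp only [Pi.sub_apply, Pi.single_eq_same]
        omega
      · simpa [hl] using this
    · have hle := x.2.2 hlm
      rcases eq_or_ne m k with rfl | hm
      · rcases eq_or_ne l m with rfl | hl
        · rfl
        · have hlm' : l < m := lt_of_le_of_ne hlm hl
          have hli : x.1 l ≤ x.1 i := x.2.2 (Fin.le_def.2 (by have := Fin.lt_def.1 hlm'; omega))
          simp only [Pi.sub_apply, Pi.single_eq_same, Pi.single_eq_of_ne hl]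
          omega
      · rcases eq_or_ne l k with rfl | hl
        · simp only [Pi.sub_apply, Pi.single_eq_same, Pi.single_eq_of_ne hm]
          omega
        · simpa [hl, hm] using hle

theorem r_add_block {v : Fin n → ℝ} (hv : ∀ i, 0 < v i) (t : ℝ) (x y : Fin n → ℤ) (k : Fin n)
    (d : ℕ) (j : Fin n) (hj : (j : ℕ) = k + d) (hx : ∀ l, k ≤ l → l ≤ j → x l = x k) :
    r v t (x + block k j) y = r v t (x + Pi.single k 1) y := by
  induction d generalizing j with
  | zero =>
    obtain rfl : j = k := Fin.ext hj
    congr 2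
    ext l
    rcases eq_or_ne l j with rfl | hl
    · simp [block]
    · have : ¬(j ≤ l ∧ l ≤ j) := fun h => hl (le_antisymm h.2 h.1)
      simp [block, this, hl]
  | succ d ih =>
    obtain ⟨i, hi⟩ : ∃ i : Fin n, (i : ℕ) = k + d := ⟨⟨k + d, by have := j.2; omega⟩, rfl⟩
    have hij : i < j := Fin.lt_def.2 (by omega)
    have hki : k ≤ i := Fin.le_def.2 (by omega)
    rw [← ih i hi fun l h1 h2 => hx l h1 (h2.trans hij.le)]
    have hb : block k j = block k i + Pi.single j 1 := by
      ext l
      have hlj : l = j ↔ (l : ℕ) = j := Fin.ext_iff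
      simp only [block, Pi.add_apply, Pi.single_apply, Fin.le_def, hlj]
      split_ifs <;> omega
    rw [hb, ← add_assoc]
    refine r_eq_of_collision hv t _ y (i := i) (by omega) ?_
    have h1 := hx j (hki.trans hij.le) le_rfl
    have h2 := hx i hki hij.le
    simp [block, hki, h1, h2, hij]

theorem r_pushRight {v : Fin n → ℝ} (hv : ∀ i, 0 < v i) (t : ℝ) (x : State n) (y : Fin n → ℤ)
    (k : Fin n) : r v t (pushRight x k).1 y = r v t (x.1 + Pi.single k 1) y := by
  obtain ⟨j, hkj, hx, hj⟩ := exists_top x k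
  rw [← block_of_top x hx hkj hj]
  exact r_add_block hv t x.1 y k (j - k) j (by have := Fin.le_def.1 hkj; omega) hx

theorem solvesBackward_r {v : Fin n → ℝ} (hv : ∀ i, 0 < v i) (y : Fin n → ℤ) :
    SolvesBackward (moveRate v) move (fun t (x : State n) => r v t x.1 y) where
  continuousOn x t _ := (hasDerivAt_r hv t x.1 y).continuousAt.continuousWithinAt
  hasDeriv t _ x := by
    refine (hasDerivAt_r hv t x.1 y).hasDerivWithinAt.congr_deriv ?_
    rw [gen, Fintype.sum_sum_type, Finset.sum_add_distrib]
    simp only [move, moveRate, Sum.elim_inl, Sum.elim_inr, r_pushRight hv, r_jumpLeft hv]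
  bounded T := by
    obtain ⟨C, hC⟩ := r_bounded hv y T
    exact ⟨C, fun t ht x => hC t ht x.1 x.2.1⟩

theorem isTransitionFunction_rate_iff {v : Fin n → ℝ} (hv : ∀ i, 0 < v i)
    (P : ℝ≥0 → State n → State n → ℝ) :
    IsTransitionFunction (rate v) P ↔ ∀ (t : ℝ≥0) (x y : State n), P t x y = r v t x.1 y.1 := by
  let : TopologicalSpace (State n) := ⊥
  have : DiscreteTopology (State n) := ⟨rfl⟩
  have hr : ∀ (t : ℝ≥0) (x y : State n),
      r v t x.1 y.1 = semigroup (moveRate v) move t (dirac y) x := by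
    intro t x y
    classical
    refine (solvesBackward_r hv y.1).eq (moveRate_nonneg hv)
      (solvesBackward_semigroup _ _ (dirac y)) (fun x => ?_) t.2 x
    rw [semigroup_zero, dirac_apply, r_zero hv x.2.1 x.2.2 y.2.1 y.2.2]
    exact if_congr ⟨fun h => Subtype.ext h, fun h => congrArg Subtype.val h⟩ rfl rfl
  constructor
  · intro hP t x y
    rw [hr, hP.eq_semigroup (moveRate_nonneg hv) (qMatrix_rate v)]
  · intro hP
    have : P = fun (t : ℝ≥0) x y => semigroup (moveRate v) move t (dirac y) x := by
      ext t x y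
      rw [hP, hr]
    rw [this]
    exact isTransitionFunction_semigroup _ (moveRate_nonneg hv) _ _ (qMatrix_rate v)

end Moves

section MarkovProperty

variable {S Ω : Type*} [MeasurableSpace Ω] {q : S → S → ℝ} {Y : ℝ≥0 → Ω → S} {μ : Measure Ω}

theorem IsMarkovChain.past_le (hY : IsMarkovChain q Y μ) (s : ℝ≥0) :
    past Y s ≤ ‹MeasurableSpace Ω› := by
  refine iSup₂_le fun u _ => ?_
  rintro _ ⟨A, -, rfl⟩
  exact hY.measurable u A

/-- The transition probabilities of a Markov chain are given by its transition
function. -/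
theorem IsMarkovChain.exists_cond_eq [IsProbabilityMeasure μ] (hY : IsMarkovChain q Y μ) :
    ∃ P, IsTransitionFunction q P ∧ ∀ (s t : ℝ≥0) (x y : S), μ (Y s ⁻¹' {x}) ≠ 0 →
      (ProbabilityTheory.cond μ (Y s ⁻¹' {x})).real (Y (s + t) ⁻¹' {y}) = P t x y := by
  obtain ⟨P, hP, hM⟩ := hY.markov
  refine ⟨P, hP, fun s t x y hx => ?_⟩
  set A := Y s ⁻¹' {x} with hA
  set B := Y (s + t) ⁻¹' {y} with hB
  have hAm : MeasurableSet A := hY.measurable s _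
  have hBm : MeasurableSet B := hY.measurable (s + t) _
  have hApast : MeasurableSet[past Y s] A :=
    (le_iSup₂ (f := fun (u : ℝ≥0) (_ : u ≤ s) => MeasurableSpace.comap (Y u) ⊤) s le_rfl) _
      ⟨{x}, trivial, rfl⟩
  have h1 : ∫ ω in A, (μ⟦B | past Y s⟧) ω ∂μ = ∫ ω in A, B.indicator (fun _ => (1 : ℝ)) ω ∂μ :=
    setIntegral_condExp (hY.past_le s) ((integrable_const 1).indicator hBm) hApast
  have h2 : ∫ ω in A, (μ⟦B | past Y s⟧) ω ∂μ = ∫ ω in A, P t x y ∂μ := by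
    refine setIntegral_congr_ae hAm ?_
    filter_upwards [hM s t y] with ω hω hωA
    rw [hω, show Y s ω = x from hωA]
  rw [h2, setIntegral_const, setIntegral_indicator hBm, setIntegral_const, smul_eq_mul,
    smul_eq_mul, mul_one] at h1
  have hA0 : μ.real A ≠ 0 := fun h => hx ((measureReal_eq_zero_iff).1 h)
  rw [measureReal_def, ProbabilityTheory.cond_apply hAm, ENNReal.toReal_mul, ENNReal.toReal_inv,
    ← measureReal_def, ← measureReal_def, ← h1]
  field_simp

end MarkovProperty

end PushASEP

end

/-- For PushASEP with a wall, `r_t(x, y)` is the transition function (and the only one) with the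
given rates, and it gives the transition probabilities of every Markov chain with these rates. -/
theorem mainTheorem5 (n : ℕ) (v : Fin n → ℝ) (hv : ∀ i, 0 < v i) :
    (∀ P : ℝ≥0 → PushASEP.State n → PushASEP.State n → ℝ,
      PushASEP.IsTransitionFunction (PushASEP.rate v) P ↔
        ∀ (t : ℝ≥0) (x y : PushASEP.State n), P t x y = PushASEP.r v t x.1 y.1) ∧
    (∀ (Ω : Type*) [MeasurableSpace Ω] (μ : Measure Ω) [IsProbabilityMeasure μ]
      (Y : ℝ≥0 → Ω → PushASEP.State n),
      PushASEP.IsMarkovChain (PushASEP.rate v) Y μ →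
        ∀ (s t : ℝ≥0) (x y : PushASEP.State n), μ (Y s ⁻¹' {x}) ≠ 0 →
          (ProbabilityTheory.cond μ (Y s ⁻¹' {x})).real (Y (s + t) ⁻¹' {y}) =
            PushASEP.r v t x.1 y.1) := by
  refine ⟨PushASEP.isTransitionFunction_rate_iff hv, fun Ω _ μ _ Y hY s t x y hx => ?_⟩
  obtain ⟨P, hP, hcond⟩ := hY.exists_cond_eq
  rw [hcond s t x y hx, (PushASEP.isTransitionFunction_rate_iff hv P).1 hP]
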